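/- Let $K=\mathbb R$ or $\mathbb C$ and let $n,m\ge 0$ be integers. Let $R=K\{y_1,\dots,y_n\}$ be the ring of convergent power series in $y=(y_1,\dots,y_n)$, with maximal ideal $\mathfrak m=(y_1,\dots,y_n)$, and let $A=R\{x\}:=K\{y_1,\dots,y_n,x_1,\dots,x_m\}$, regarded as an $R$-algebra by the inclusion. For $g=g(y,x)\in A$ write $g(0,x)\in K\{x_1,\dots,x_m\}$ for its evaluation at $y=0$. Let $F$ be a finitely generated $A$-module. (A) There exist $g\in A$, an integer $l\ge 0$ and a homomorphism of $A$-modules $\psi\colon A^l\to F$ such that $$g(0,x)\neq 0,\qquad g\cdot F\subset \operatorname{im}\psi,\qquad \ker\psi\subset \mathfrak m\cdot A^l. \qquad (*)$$ (B) Let $J$ be any ideal of $R$. Then $F\otimes_R R/J$ is a flat $R/J$-module if and only if, for every choice of $g\in A$, $l\ge 0$ and $\psi\colon A^l\to F$ satisfying $(*)$, the following two conditions hold: 1. $\ker\psi\subset J\cdot A^l$; 2. $(F/\operatorname{im}\psi)\otimes_R R/J$ is a flat $R/J$-module. Moreover, if conditions 1 and 2 hold for a single choice of $g,l,\psi$ satisfying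 $(*)$, then $F\otimes_R R/J$ is already a flat $R/J$-module. -/

import Mathlib

open scoped TensorProduct

noncomputable section

/-- A formal power series (in finitely many variables) is convergent if it converges absolutely
on some polydisc of positive radius `r` centred at the origin. -/
def IsConvergentSeries {K : Type*} [RCLike K] {σ : Type*} (f : MvPowerSeries σ K) : Prop :=
  ∃ r : ℝ, 0 < r ∧ Summable fun d : σ →₀ ℕ => ‖MvPowerSeries.coeff d f‖ * r ^ d.degree

namespace IsConvergentSeries

variable {K : Type*} [RCLike K] {σ τ : Type*}

theorem summable_of_le {f : MvPowerSeries σ K} {r s : ℝ} (hs : 0 ≤ s) (h : s ≤ r)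
    (hf : Summable fun d : σ →₀ ℕ => ‖MvPowerSeries.coeff d f‖ * r ^ d.degree) :
    Summable fun d : σ →₀ ℕ => ‖MvPowerSeries.coeff d f‖ * s ^ d.degree :=
  Summable.of_nonneg_of_le (fun d => by positivity) (fun d => by gcongr) hf

theorem monomial (n : σ →₀ ℕ) (a : K) : IsConvergentSeries (MvPowerSeries.monomial n a) := by
  classical
  refine ⟨1, one_pos, summable_of_ne_finset_zero (s := {n}) fun d hd => ?_⟩
  have : d ≠ n := by simpa using hd
  simp [MvPowerSeries.coeff_monomial, this]

theorem add {f g : MvPowerSeries σ K} (hf : IsConvergentSeries f) (hg : IsConvergentSeries g) :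
    IsConvergentSeries (f + g) := by
  obtain ⟨r, hr, hf⟩ := hf
  obtain ⟨s, hs, hg⟩ := hg
  have ht : 0 < min r s := lt_min hr hs
  refine ⟨min r s, ht, Summable.of_nonneg_of_le (fun d => by positivity) (fun d => ?_)
    ((summable_of_le ht.le (min_le_left r s) hf).add
      (summable_of_le ht.le (min_le_right r s) hg))⟩
  rw [← add_mul, map_add]
  gcongr
  exact norm_add_le _ _

theorem mul {f g : MvPowerSeries σ K} (hf : IsConvergentSeries f) (hg : IsConvergentSeries g) :
    IsConvergentSeries (f * g) := by
  classical
  obtain ⟨r, hr, hf⟩ := hf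
  obtain ⟨s, hs, hg⟩ := hg
  obtain ⟨t, ht, htr, hts⟩ : ∃ t : ℝ, 0 < t ∧ t ≤ r ∧ t ≤ s :=
    ⟨min r s, lt_min hr hs, min_le_left r s, min_le_right r s⟩
  let u : (σ →₀ ℕ) → ℝ := fun d => ‖MvPowerSeries.coeff d f‖ * t ^ d.degree
  let v : (σ →₀ ℕ) → ℝ := fun d => ‖MvPowerSeries.coeff d g‖ * t ^ d.degree
  have hu : Summable u := summable_of_le ht.le htr hf
  have hv : Summable v := summable_of_le ht.le hts hg
  have hu0 : 0 ≤ u := fun d => mul_nonneg (norm_nonneg _) (pow_nonneg ht.le _)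
  have hv0 : 0 ≤ v := fun d => mul_nonneg (norm_nonneg _) (pow_nonneg ht.le _)
  have key : Summable fun d : σ →₀ ℕ => ∑ p ∈ Finset.HasAntidiagonal.antidiagonal d, u p.1 * v p.2 :=
    summable_sum_mul_antidiagonal_of_summable_mul (hu.mul_of_nonneg hv hu0 hv0)
  refine ⟨t, ht, Summable.of_nonneg_of_le
    (fun d => mul_nonneg (norm_nonneg _) (pow_nonneg ht.le _)) (fun d => ?_) key⟩
  rw [MvPowerSeries.coeff_mul]
  refine (mul_le_mul_of_nonneg_right (norm_sum_le _ _) (pow_nonneg ht.le _)).trans ?_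
  rw [Finset.sum_mul]
  refine Finset.sum_le_sum fun p hp => le_of_eq ?_
  simp only [u, v]
  rw [← Finset.HasAntidiagonal.mem_antidiagonal.mp hp, map_add, pow_add, norm_mul]
  ring

theorem rename (e : σ ↪ τ) {f : MvPowerSeries σ K} (hf : IsConvergentSeries f) :
    IsConvergentSeries (MvPowerSeries.rename e f) := by
  obtain ⟨r, hr, hf⟩ := hf
  refine ⟨r, hr, ?_⟩
  rw [← (Finsupp.embDomain_injective e).summable_iff (fun d hd => ?_)]
  · refine hf.congr fun d => ?_
    have hd : (Finsupp.embDomain e d).degree = d.degree := by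
      rw [Finsupp.embDomain_eq_mapDomain, Finsupp.degree_mapDomain]
    simp only [Function.comp_apply, MvPowerSeries.coeff_embDomain_rename, hd]
  · rw [MvPowerSeries.coeff_rename_eq_zero]
    · simp
    · rintro ⟨x, rfl⟩
      exact hd ⟨x, Finsupp.embDomain_eq_mapDomain e x⟩

theorem killCompl (e : σ ↪ τ) {f : MvPowerSeries τ K} (hf : IsConvergentSeries f) :
    IsConvergentSeries (MvPowerSeries.killCompl e f) := by
  obtain ⟨r, hr, hf⟩ := hf
  refine ⟨r, hr, (hf.comp_injective (Finsupp.embDomain_injective e)).congr fun d => ?_⟩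
  simp [MvPowerSeries.coeff_killCompl, Finsupp.embDomain_eq_mapDomain, Finsupp.degree_mapDomain]

end IsConvergentSeries

/-- The convergent power series form a subalgebra of the formal power series. -/
def convergentSubalgebra (K : Type*) [RCLike K] (σ : Type*) :
    Subalgebra K (MvPowerSeries σ K) where
  carrier := {f | IsConvergentSeries f}
  mul_mem' := IsConvergentSeries.mul
  add_mem' := IsConvergentSeries.add
  algebraMap_mem' a := IsConvergentSeries.monomial 0 a

/-- The ring `K{z}` of convergent power series in variables `z` indexed by `σ`. -/
def ConvergentPowerSeries (K : Type*) [RCLike K] (σ : Type*) : Type _ :=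
  convergentSubalgebra K σ

namespace ConvergentPowerSeries

instance (K : Type*) [RCLike K] (σ : Type*) : CommRing (ConvergentPowerSeries K σ) :=
  inferInstanceAs (CommRing (convergentSubalgebra K σ))

instance (K : Type*) [RCLike K] (σ : Type*) : Algebra K (ConvergentPowerSeries K σ) :=
  inferInstanceAs (Algebra K (convergentSubalgebra K σ))

/-- The underlying formal power series, as an algebra homomorphism. -/
def toFormal (K : Type*) [RCLike K] (σ : Type*) :
    ConvergentPowerSeries K σ →ₐ[K] MvPowerSeries σ K :=
  (convergentSubalgebra K σ).val

/-- The variable `z i` as an element of `K{z}`. -/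
def X {K : Type*} [RCLike K] {σ : Type*} (i : σ) : ConvergentPowerSeries K σ :=
  ⟨MvPowerSeries.X i, IsConvergentSeries.monomial _ 1⟩

/-- The inclusion `K{y} → K{y, x}`, where `y` is indexed by `σ` and `x` by `τ`. -/
def inclusion (K : Type*) [RCLike K] (σ τ : Type*) :
    ConvergentPowerSeries K σ →ₐ[K] ConvergentPowerSeries K (σ ⊕ τ) :=
  ((MvPowerSeries.rename (Function.Embedding.inl : σ ↪ σ ⊕ τ)).comp
    (toFormal K σ)).codRestrict (convergentSubalgebra K (σ ⊕ τ))
      fun f => IsConvergentSeries.rename Function.Embedding.inl f.2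

/-- `K{y, x}` as an algebra over `K{y}`. -/
instance algebraSum (K : Type*) [RCLike K] (σ τ : Type*) :
    Algebra (ConvergentPowerSeries K σ) (ConvergentPowerSeries K (σ ⊕ τ)) :=
  (inclusion K σ τ).toRingHom.toAlgebra

/-- The evaluation `f(y, x) ↦ f(0, x)` from `K{y, x}` to `K{x}`: monomials containing some `y i`
are sent to zero, and monomials in `x` alone are kept. -/
def evalZero (K : Type*) [RCLike K] (σ τ : Type*) :
    ConvergentPowerSeries K (σ ⊕ τ) →ₐ[K] ConvergentPowerSeries K τ :=
  ((MvPowerSeries.killCompl (Function.Embedding.inr : τ ↪ σ ⊕ τ)).comp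
    (toFormal K (σ ⊕ τ))).codRestrict (convergentSubalgebra K τ)
      fun f => IsConvergentSeries.killCompl Function.Embedding.inr f.2

/-- The ideal of `K{y}` generated by all the variables `y i`. -/
def varIdeal (K : Type*) [RCLike K] (σ : Type*) : Ideal (ConvergentPowerSeries K σ) :=
  Ideal.span (Set.range X)

end ConvergentPowerSeries

/-- The ring `R = K{y}`, `y = (y_1, …, y_n)`. -/
abbrev SeriesRingY (K : Type*) [RCLike K] (n : ℕ) : Type _ :=
  ConvergentPowerSeries K (Fin n)

/-- The ring `A = R{x} = K{y, x}`, `y = (y_1, …, y_n)`, `x = (x_1, …, x_m)`. -/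
abbrev SeriesRingYX (K : Type*) [RCLike K] (n m : ℕ) : Type _ :=
  ConvergentPowerSeries K (Fin n ⊕ Fin m)

/-- For an ideal `I` of `R = K{y}`, the submodule `I · A^l` of `A^l`, where `A = K{y, x}`. -/
def idealMulPow {K : Type*} [RCLike K] {n : ℕ} (m : ℕ) (I : Ideal (SeriesRingY K n)) (l : ℕ) :
    Submodule (SeriesRingYX K n m) (Fin l → SeriesRingYX K n m) :=
  I.map (algebraMap (SeriesRingY K n) (SeriesRingYX K n m)) • ⊤

/-- The conditions on `g ∈ A` and `ψ : A^l → F`: `g(0, x) ≠ 0`, `g · F ⊆ im ψ`, and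
`ker ψ ⊆ 𝔪 · A^l`, where `𝔪 = (y_1, …, y_n)`. -/
def IsReducingPair {K : Type*} [RCLike K] {n m : ℕ} {F : Type*} [AddCommGroup F]
    [Module (SeriesRingYX K n m) F] (g : SeriesRingYX K n m) {l : ℕ}
    (ψ : (Fin l → SeriesRingYX K n m) →ₗ[SeriesRingYX K n m] F) : Prop :=
  ConvergentPowerSeries.evalZero K (Fin n) (Fin m) g ≠ 0 ∧
    (∀ f : F, g • f ∈ LinearMap.range ψ) ∧
    LinearMap.ker ψ ≤ idealMulPow m (ConvergentPowerSeries.varIdeal K (Fin n)) l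

end

/-! ### Flatness modulo an ideal, expressed by equations -/

section RelativeFlatness

/-! Call a map ψ : M → F injective modulo I when ψ v ∈ I F forces v ∈ I M. Let P = 𝔪A; it is the
kernel of evaluation at y = 0, hence prime, and g(0, x) ≠ 0 means g ∉ P.

For (A), choose among finitely many generators of F a maximal subfamily independent modulo P. It
defines ψ, and some a ∉ P carries F into im ψ + P F. Cayley–Hamilton on the cokernel turns a into
some g ∉ P with g F ⊆ im ψ.

For (B), if g F ⊆ im ψ and ker ψ ⊆ I A^l, then ψ v ∈ I F implies g v ∈ I A^l. With I = 𝔪, primality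
of P cancels g, so ψ is injective modulo 𝔪. The key is a form of the local criterion,
`IsFlatModulo.mem_smul_top_of_map_mem`: a map into a module flat modulo I that is injective modulo 𝔪
is injective modulo I. If F is flat modulo J, this makes ψ injective modulo every ideal containing
J, which yields both conditions (`IsFlatModulo.cokernel`). Conversely, the criterion applied to
multiplication by g on the flat module A^l cancels g modulo J. Then ψ is injective modulo J, and F
is an extension of flat by flat (`IsFlatModulo.of_extension`).

The analytic input is that convergent power series rings are Noetherian and local, that K{y, x} is
flat over K{y}, and that the y_i generate the kernel of evaluation. All of it comes from the
division theorem `exists_division`. -/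

theorem exists_sum_of_mem_span_range_smul_top {R M ι : Type*} [CommRing R] [AddCommGroup M]
    [Module R M] [Fintype ι] (e : ι → R) {x : M}
    (hx : x ∈ (Ideal.span (Set.range e) • ⊤ : Submodule R M)) :
    ∃ w : ι → M, x = ∑ i, e i • w i := by
  induction hx using Submodule.smul_induction_on' with
  | smul r hr n hn =>
    obtain ⟨c, hc⟩ := (Ideal.mem_span_range_iff_exists_fun).1 hr
    exact ⟨fun i => c i • n, by simp [← hc, Finset.sum_smul, smul_smul, mul_comm]⟩
  | add x _ y _ ihx ihy =>
    obtain ⟨w, rfl⟩ := ihx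
    obtain ⟨w', rfl⟩ := ihy
    exact ⟨w + w', by simp [Finset.sum_add_distrib]⟩

variable {R : Type*} [CommRing R]

/-- The equational criterion for flatness of `F / I F` over `R / I`, phrased in `R` and `F`. -/
def IsFlatModulo (I : Ideal R) (F : Type*) [AddCommGroup F] [Module R F] : Prop :=
  ∀ (l : ℕ) (a : Fin l → R) (f : Fin l → F), ∑ i, a i • f i ∈ (I • ⊤ : Submodule R F) →
    ∃ (k : ℕ) (b : Fin l → Fin k → R) (g : Fin k → F),
      (∀ i, f i - ∑ j, b i j • g j ∈ (I • ⊤ : Submodule R F)) ∧ ∀ j, ∑ i, a i * b i j ∈ I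

variable {F : Type*} [AddCommGroup F] [Module R F]

theorem one_tmul_eq_zero_iff (I : Ideal R) (f : F) :
    (1 : R ⧸ I) ⊗ₜ[R] f = 0 ↔ f ∈ (I • ⊤ : Submodule R F) := by
  rw [← (TensorProduct.quotTensorEquivQuotSMul F I).map_eq_zero_iff,
    TensorProduct.quotTensorEquivQuotSMul_mk_one_tmul, Submodule.Quotient.mk_eq_zero]

theorem exists_one_tmul_eq (I : Ideal R) (z : (R ⧸ I) ⊗[R] F) :
    ∃ f : F, (1 : R ⧸ I) ⊗ₜ[R] f = z := by
  obtain ⟨f, hf⟩ := Submodule.Quotient.mk_surjective _ (TensorProduct.quotTensorEquivQuotSMul F I z)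
  refine ⟨f, (TensorProduct.quotTensorEquivQuotSMul F I).injective ?_⟩
  rw [TensorProduct.quotTensorEquivQuotSMul_mk_one_tmul, hf]

theorem mk_smul_one_tmul (I : Ideal R) (a : R) (f : F) :
    Ideal.Quotient.mk I a • ((1 : R ⧸ I) ⊗ₜ[R] f) = (1 : R ⧸ I) ⊗ₜ[R] (a • f) := by
  rw [TensorProduct.smul_tmul', TensorProduct.tmul_smul, TensorProduct.smul_tmul']
  simp [Algebra.smul_def]

/-- Every element of the base change is 1 ⊗ f, and it vanishes exactly when f ∈ I F. Relations and
their trivializations therefore lift, with equality replaced by congruence modulo I. -/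
theorem flat_quotient_tensor_iff (I : Ideal R) :
    Module.Flat (R ⧸ I) ((R ⧸ I) ⊗[R] F) ↔ IsFlatModulo I F := by
  rw [Module.Flat.iff_forall_isTrivialRelation]
  constructor
  · intro h l a f haf
    have h0 : ∑ i, Ideal.Quotient.mk I (a i) • ((1 : R ⧸ I) ⊗ₜ[R] f i) = 0 := by
      simp_rw [mk_smul_one_tmul, ← TensorProduct.tmul_sum]
      rwa [one_tmul_eq_zero_iff]
    obtain ⟨k, b, g, hf, hb⟩ := h h0
    choose b' hb' using fun i j => Ideal.Quotient.mk_surjective (b i j)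
    choose g' hg' using fun j => exists_one_tmul_eq I (g j)
    refine ⟨k, b', g', fun i => ?_, fun j => ?_⟩
    · rw [← one_tmul_eq_zero_iff, TensorProduct.tmul_sub, sub_eq_zero, TensorProduct.tmul_sum]
      refine (hf i).trans ?_
      simp_rw [← mk_smul_one_tmul, hb', hg']
    · rw [← Ideal.Quotient.eq_zero_iff_mem, map_sum]
      simpa [hb'] using hb j
  · intro h l a f haf
    choose a' ha' using fun i => Ideal.Quotient.mk_surjective (a i)
    choose f' hf' using fun j => exists_one_tmul_eq I (f j)
    obtain ⟨k, b, g, hf, hb⟩ := h l a' f' (by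
      rw [← one_tmul_eq_zero_iff, TensorProduct.tmul_sum]
      simpa only [← mk_smul_one_tmul, ha', hf'] using haf)
    refine ⟨k, fun i j => Ideal.Quotient.mk I (b i j), fun j => 1 ⊗ₜ g j, fun i => ?_, fun j => ?_⟩
    · have := (one_tmul_eq_zero_iff I _).2 (hf i)
      rw [TensorProduct.tmul_sub, sub_eq_zero, TensorProduct.tmul_sum, hf'] at this
      simpa only [mk_smul_one_tmul] using this
    · have := Ideal.Quotient.eq_zero_iff_mem.2 (hb j)
      rw [map_sum] at this
      simpa [ha'] using this

namespace IsFlatModulo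

variable {I : Ideal R}

theorem exists_of_sum_mem (h : IsFlatModulo I F) {ι : Type*} [Fintype ι] (a : ι → R) (f : ι → F)
    (haf : ∑ i, a i • f i ∈ (I • ⊤ : Submodule R F)) :
    ∃ (k : ℕ) (b : ι → Fin k → R) (g : Fin k → F),
      (∀ i, f i - ∑ j, b i j • g j ∈ (I • ⊤ : Submodule R F)) ∧ ∀ j, ∑ i, a i * b i j ∈ I := by
  let e := Fintype.equivFin ι
  obtain ⟨k, b, g, hf, hb⟩ := h _ (a ∘ e.symm) (f ∘ e.symm) (by
    simpa [Equiv.sum_comp e.symm (fun i => a i • f i)] using haf)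
  refine ⟨k, fun i => b (e i), g, fun i => by simpa using hf (e i), fun j => ?_⟩
  rw [← Equiv.sum_comp e.symm (fun i => a i * b (e i) j)]
  simpa using hb j

theorem of_fintype (h : ∀ (l : ℕ) (a : Fin l → R) (f : Fin l → F),
    ∑ i, a i • f i ∈ (I • ⊤ : Submodule R F) →
      ∃ (κ : Type) (_ : Fintype κ) (b : Fin l → κ → R) (g : κ → F),
      (∀ i, f i - ∑ j, b i j • g j ∈ (I • ⊤ : Submodule R F)) ∧ ∀ j, ∑ i, a i * b i j ∈ I) :
    IsFlatModulo I F := by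
  intro l a f haf
  obtain ⟨κ, _, b, g, hf, hb⟩ := h l a f haf
  let e := Fintype.equivFin κ
  refine ⟨_, fun i => b i ∘ e.symm, g ∘ e.symm, fun i => ?_, fun j => hb _⟩
  simpa [Equiv.sum_comp e.symm (fun j => b i j • g j)] using hf i

theorem exists_fin_sum_of_mem_smul_top {x : F} (hx : x ∈ (I • ⊤ : Submodule R F)) :
    ∃ (k : ℕ) (c : Fin k → R) (g : Fin k → F), (∀ j, c j ∈ I) ∧ x = ∑ j, c j • g j := by
  induction hx using Submodule.smul_induction_on' with
  | smul r hr n hn => exact ⟨1, fun _ => r, fun _ => n, fun _ => hr, by simp⟩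
  | add x _ y _ ihx ihy =>
    obtain ⟨k, c, g, hc, rfl⟩ := ihx
    obtain ⟨k', c', g', hc', rfl⟩ := ihy
    refine ⟨k + k', Fin.append c c', Fin.append g g', fun j => ?_, ?_⟩
    · induction j using Fin.addCases <;> simp [hc, hc']
    · simp [Fin.sum_univ_add]

/-- A relation modulo I' becomes an exact one once the I'-combination on the right is moved to the
left. After trivializing it, the extra terms have coefficients in I' and drop out. -/
theorem mono (h : IsFlatModulo I F) {I' : Ideal R} (hI : I ≤ I') : IsFlatModulo I' F := by
  intro l a f haf
  obtain ⟨s, c, u, hc, hu⟩ := exists_fin_sum_of_mem_smul_top haf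
  obtain ⟨k, b, g, hf, hb⟩ := h.exists_of_sum_mem (Sum.elim a (-c)) (Sum.elim f u) (by
    simp [hu])
  refine ⟨k, fun i => b (.inl i), g,
    fun i => Submodule.smul_mono_left hI (hf (.inl i)), fun j => ?_⟩
  have h1 := hI (hb j)
  rw [Fintype.sum_sum_type] at h1
  refine (Ideal.add_mem_iff_left _ (I'.sum_mem fun i _ => ?_)).1 h1
  exact I'.mul_mem_right _ (by simpa using hc i)

/-- An extension of a flat module by a flat module is flat. -/
theorem of_extension {M C : Type*} [AddCommGroup M] [Module R M] [AddCommGroup C] [Module R C]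
    {ψ : M →ₗ[R] F} {q : F →ₗ[R] C} (hex : Function.Exact ψ q) (hqs : Function.Surjective q)
    (hM : IsFlatModulo I M) (hC : IsFlatModulo I C)
    (hψ : ∀ v, ψ v ∈ (I • ⊤ : Submodule R F) → v ∈ (I • ⊤ : Submodule R M)) :
    IsFlatModulo I F := by
  refine of_fintype fun l a f haf => ?_
  have hmap : (I • ⊤ : Submodule R C) = (I • ⊤ : Submodule R F).map q := by
    rw [Submodule.map_smul'', Submodule.map_top, LinearMap.range_eq_top.2 hqs]
  have hq : ∀ y ∈ (I • ⊤ : Submodule R C), ∃ x ∈ (I • ⊤ : Submodule R F), q x = y :=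
    fun y hy => by rwa [hmap] at hy
  obtain ⟨k, b, g, hf, hb⟩ := hC l a (q ∘ f) (by
    simpa using Submodule.smul_top_le_comap_smul_top I q haf)
  choose g' hg' using fun j => hqs (g j)
  choose x hx hxf using fun i => hq _ (hf i)
  -- Once the relation is trivialized in C, what is left of each f i, up to I F, comes from M. The v
  -- i then satisfy the same relation modulo I, because ψ is injective there.
  have hv : ∀ i, ∃ v, ψ v = f i - ∑ j, b i j • g' j - x i := by
    intro i
    refine (hex _).1 ?_
    rw [map_sub, map_sub, hxf, map_sum]
    simp only [map_smul, Function.comp_apply]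
    simp only [hg', sub_self]
  choose v hv using hv
  have hsum : ∑ i, a i • v i ∈ (I • ⊤ : Submodule R M) := by
    apply hψ
    have : ψ (∑ i, a i • v i) =
        ∑ i, a i • f i - ∑ j, (∑ i, a i * b i j) • g' j - ∑ i, a i • x i := by
      simp only [map_sum, map_smul, hv, smul_sub, Finset.sum_sub_distrib, Finset.sum_smul,
        Finset.smul_sum, smul_smul]
      rw [Finset.sum_comm]
    rw [this]
    exact sub_mem (sub_mem haf (sum_mem fun j _ => Submodule.smul_mem_smul (hb j) trivial))
      (sum_mem fun i _ => Submodule.smul_mem _ _ (hx i))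
  obtain ⟨k', b', w, hw, hb'⟩ := hM l a v hsum
  refine ⟨Fin k ⊕ Fin k', inferInstance, fun i => Sum.elim (b i) (b' i), Sum.elim g' (ψ ∘ w),
    fun i => ?_, fun j => ?_⟩
  · have h1 : ψ (v i - ∑ j, b' i j • w j) ∈ (I • ⊤ : Submodule R F) :=
      Submodule.smul_top_le_comap_smul_top I ψ (hw i)
    have h2 := add_mem h1 (hx i)
    convert h2 using 1
    simp [Fintype.sum_sum_type, hv]
    abel
  · cases j <;> simp [hb, hb']

/-- If `ψ : M → F` is injective modulo every ideal containing `I`, then the cokernel of `ψ` is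
flat modulo `I` as soon as `F` is. -/
theorem cokernel {M C : Type*} [AddCommGroup M] [Module R M] [AddCommGroup C] [Module R C]
    {ψ : M →ₗ[R] F} {q : F →ₗ[R] C} (hex : Function.Exact ψ q) (hqs : Function.Surjective q)
    (hF : IsFlatModulo I F)
    (hψ : ∀ I' : Ideal R, I ≤ I' →
      ∀ v, ψ v ∈ (I' • ⊤ : Submodule R F) → v ∈ (I' • ⊤ : Submodule R M)) :
    IsFlatModulo I C := by
  intro l a f haf
  have hmap : (I • ⊤ : Submodule R C) = (I • ⊤ : Submodule R F).map q := by
    rw [Submodule.map_smul'', Submodule.map_top, LinearMap.range_eq_top.2 hqs]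
  choose f' hf' using fun i => hqs (f i)
  rw [hmap] at haf
  obtain ⟨x, hx, hxf⟩ := haf
  obtain ⟨v, hv⟩ : ∃ v, ψ v = ∑ i, a i • f' i - x := by
    refine (hex _).1 ?_
    rw [map_sub, hxf, map_sum]
    simp [hf']
  -- Injectivity modulo (a) + I gives v = ∑ a i • w i up to I M. Replacing f' i by f' i - ψ (w i)
  -- leaves its image in C unchanged and makes the relation hold in F modulo I.
  have hv' := hψ (Ideal.span (Set.range a) ⊔ I) le_sup_right v (by
    rw [hv]
    refine sub_mem (sum_mem fun i _ => Submodule.smul_mem_smul ?_ trivial)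
      (Submodule.smul_mono_left le_sup_right hx)
    exact Ideal.mem_sup_left (Ideal.subset_span ⟨i, rfl⟩))
  rw [Submodule.sup_smul, Submodule.mem_sup] at hv'
  obtain ⟨v1, hv1, v2, hv2, rfl⟩ := hv'
  obtain ⟨w, hw⟩ := exists_sum_of_mem_span_range_smul_top a hv1
  have h2 : ψ v2 ∈ (I • ⊤ : Submodule R F) :=
    Submodule.smul_top_le_comap_smul_top I ψ hv2
  obtain ⟨k, b, g, hg, hb⟩ := hF l a (fun i => f' i - ψ (w i)) (by
    have : ∑ i, a i • (f' i - ψ (w i)) = x + ψ v2 := by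
      rw [map_add, hw] at hv
      simp only [smul_sub, Finset.sum_sub_distrib]
      simp only [map_sum, map_smul] at hv
      rw [sub_eq_iff_eq_add, add_assoc, add_comm (ψ v2), hv]
      abel
    rw [this]
    exact add_mem hx h2)
  refine ⟨k, b, q ∘ g, fun i => ?_, hb⟩
  rw [hmap]
  refine ⟨_, hg i, ?_⟩
  simp [hf', hex.apply_apply_eq_zero]

end IsFlatModulo

end RelativeFlatness

/-! ### The local criterion: from injectivity modulo 𝔪 to injectivity modulo I -/

section LocalCriterion

open IsLocalRing

/-- Minimal generators of a finitely generated ideal `Q` modulo `I` satisfy only relations with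
coefficients in the maximal ideal. -/
theorem exists_minimal_generators_modulo {R : Type*} [CommRing R] [IsLocalRing R] (I Q : Ideal R)
    (hQ : Q.FG) :
    ∃ (k : ℕ) (e : Fin k → R), (∀ i, e i ∈ Q) ∧ Q ≤ Ideal.span (Set.range e) ⊔ I ∧
      ∀ a : Fin k → R, ∑ i, a i * e i ∈ I → ∀ i, a i ∈ maximalIdeal R := by
  classical
  have hex : ∃ k, ∃ e : Fin k → R, (∀ i, e i ∈ Q) ∧ Q ≤ Ideal.span (Set.range e) ⊔ I := by
    obtain ⟨k, e, he⟩ := Submodule.fg_iff_exists_fin_generating_family.1 hQ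
    refine ⟨k, e, fun i => he ▸ Submodule.subset_span ⟨i, rfl⟩, ?_⟩
    exact le_sup_of_le_left he.ge
  obtain ⟨e, he, hQe⟩ := Nat.find_spec hex
  refine ⟨Nat.find hex, e, he, hQe, fun a ha i₀ => ?_⟩
  -- A unit coefficient would express e i₀ through the other generators modulo I, against the
  -- minimality of their number.
  by_contra hi
  rw [mem_maximalIdeal, mem_nonunits_iff, not_not] at hi
  obtain ⟨k, hk⟩ : ∃ k, Nat.find hex = k + 1 :=
    Nat.exists_eq_succ_of_ne_zero (Nat.ne_of_gt i₀.pos)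
  refine Nat.find_min hex (m := k) (by omega) ?_
  revert e a i₀
  rw [hk]
  intro e he hQe a ha i₀ hi
  refine ⟨e ∘ i₀.succAbove, fun i => he _, hQe.trans (sup_le ?_ le_sup_right)⟩
  rw [Ideal.span_le]
  have hrest : ∀ i, e (i₀.succAbove i) ∈ Ideal.span (Set.range (e ∘ i₀.succAbove)) ⊔ I :=
    fun i => Ideal.mem_sup_left (Ideal.subset_span ⟨i, rfl⟩)
  rintro _ ⟨i, rfl⟩
  obtain rfl | ⟨j, rfl⟩ := Fin.eq_self_or_eq_succAbove i₀ i
  · rw [Fin.sum_univ_succAbove _ i] at ha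
    rw [SetLike.mem_coe, ← Ideal.unit_mul_mem_iff_mem _ hi]
    refine (Ideal.add_mem_iff_left _ (sum_mem fun j _ => ?_)).1 (Ideal.mem_sup_right ha)
    exact Ideal.mul_mem_left _ _ (hrest j)
  · exact hrest j

variable {R : Type*} [CommRing R]

/-- Inductive step: modulo I M, v = ∑ e i • w i with minimal generators e of 𝔪^n modulo I. Flatness
trivializes ∑ e i • ψ (w i) ∈ I F, and minimality puts the trivializing coefficients in 𝔪. Hence ψ
(w i) ∈ 𝔪 F, so w i ∈ 𝔪 M, which gains one power of 𝔪. -/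
theorem mem_maximalIdeal_pow_sup_smul_top [IsLocalRing R] [IsNoetherianRing R] {I : Ideal R}
    (hI : I ≤ maximalIdeal R) {M F : Type*} [AddCommGroup M] [Module R M] [AddCommGroup F]
    [Module R F] (hF : IsFlatModulo I F) (ψ : M →ₗ[R] F)
    (hψ : ∀ v, ψ v ∈ (maximalIdeal R • ⊤ : Submodule R F) →
      v ∈ (maximalIdeal R • ⊤ : Submodule R M))
    {v : M} (hv : ψ v ∈ (I • ⊤ : Submodule R F)) (n : ℕ) :
    v ∈ ((maximalIdeal R ^ n ⊔ I) • ⊤ : Submodule R M) := by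
  induction n with
  | zero => simp
  | succ n ih =>
    obtain ⟨k, e, he, hspan, hmin⟩ :=
      exists_minimal_generators_modulo I (maximalIdeal R ^ n) (IsNoetherian.noetherian _)
    have hv' := Submodule.smul_mono_left (sup_le hspan le_sup_right) ih
    rw [Submodule.sup_smul, Submodule.mem_sup] at hv'
    obtain ⟨v₁, hv₁, v₂, hv₂, rfl⟩ := hv'
    obtain ⟨w, rfl⟩ := exists_sum_of_mem_span_range_smul_top e hv₁
    have h₂ : ψ v₂ ∈ (I • ⊤ : Submodule R F) := Submodule.smul_top_le_comap_smul_top I ψ hv₂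
    rw [map_add, Submodule.add_mem_iff_left _ h₂] at hv
    obtain ⟨s, b, g, hg, hb⟩ := hF k e (ψ ∘ w) (by simpa using hv)
    have hw : ∀ i, w i ∈ (maximalIdeal R • ⊤ : Submodule R M) := by
      refine fun i => hψ _ ?_
      have := Submodule.smul_mono_left hI (hg i)
      rw [sub_eq_add_neg, Submodule.add_mem_iff_left] at this
      · exact this
      · refine neg_mem (sum_mem fun j _ => Submodule.smul_mem_smul ?_ trivial)
        exact hmin (fun i => b i j) (by simpa only [mul_comm] using hb j) i
    rw [Submodule.sup_smul]
    refine add_mem (Submodule.mem_sup_left (sum_mem fun i _ => ?_)) (Submodule.mem_sup_right hv₂)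
    rw [pow_succ, mul_comm, Submodule.mul_smul, ← Submodule.mul_smul, mul_comm, Submodule.mul_smul]
    exact Submodule.smul_mem_smul (he i) (hw i)

variable {A : Type*} [CommRing A] [Algebra R A]

theorem mem_map_smul_top_iff {M : Type*} [AddCommGroup M] [Module A M] [Module R M]
    [IsScalarTower R A M] (I : Ideal R) (v : M) :
    v ∈ (I.map (algebraMap R A) • ⊤ : Submodule A M) ↔ v ∈ (I • ⊤ : Submodule R M) := by
  rw [← Submodule.restrictScalars_mem R, ← Submodule.restrictScalars_top R A M,
    Ideal.smul_restrictScalars]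

/-- Krull's intersection theorem for a finite module over a Noetherian algebra. -/
theorem mem_smul_top_of_forall_mem_pow_sup [IsNoetherianRing A] {Q : Ideal R}
    (hQ : Q.map (algebraMap R A) ≤ Ideal.jacobson ⊥) {M : Type*} [AddCommGroup M] [Module A M]
    [Module R M] [IsScalarTower R A M] [Module.Finite A M] (I : Ideal R) {v : M}
    (hv : ∀ n : ℕ, v ∈ ((Q ^ n ⊔ I) • ⊤ : Submodule R M)) : v ∈ (I • ⊤ : Submodule R M) := by
  let N : Submodule A M := I.map (algebraMap R A) • ⊤
  have h0 : N.mkQ v = 0 := by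
    rw [← Submodule.mem_bot A, ← Ideal.iInf_pow_smul_eq_bot_of_le_jacobson _ hQ, Submodule.mem_iInf]
    intro n
    have h1 := hv n
    rw [Submodule.sup_smul, Submodule.mem_sup] at h1
    obtain ⟨v₁, hv₁, v₂, hv₂, rfl⟩ := h1
    have h2 : N.mkQ v₂ = 0 := by
      simpa [N] using (mem_map_smul_top_iff (A := A) I v₂).2 hv₂
    rw [map_add, h2, add_zero, ← Ideal.map_pow]
    exact Submodule.smul_top_le_comap_smul_top _ N.mkQ ((mem_map_smul_top_iff _ v₁).2 hv₁)
  rw [← mem_map_smul_top_iff (A := A)]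
  simpa [N] using h0

/-- A linear map from a finite module over a Noetherian `R`-algebra to a module flat modulo `I`
that is injective modulo the maximal ideal of `R` is injective modulo `I`. -/
theorem IsFlatModulo.mem_smul_top_of_map_mem [IsLocalRing R] [IsNoetherianRing R]
    [IsNoetherianRing A] (hA : (maximalIdeal R).map (algebraMap R A) ≤ Ideal.jacobson ⊥)
    {M F : Type*} [AddCommGroup M] [Module A M] [Module R M] [IsScalarTower R A M]
    [Module.Finite A M] [AddCommGroup F] [Module R F] {I : Ideal R} (hF : IsFlatModulo I F)
    (hI : I ≤ maximalIdeal R) (ψ : M →ₗ[R] F)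
    (hψ : ∀ v, ψ v ∈ (maximalIdeal R • ⊤ : Submodule R F) →
      v ∈ (maximalIdeal R • ⊤ : Submodule R M))
    (v : M) (hv : ψ v ∈ (I • ⊤ : Submodule R F)) : v ∈ (I • ⊤ : Submodule R M) :=
  mem_smul_top_of_forall_mem_pow_sup hA I
    (mem_maximalIdeal_pow_sup_smul_top hI hF ψ hψ hv)

theorem Module.Flat.isFlatModulo {M : Type*} [AddCommGroup M] [Module R M] [Module.Flat R M]
    (I : Ideal R) : IsFlatModulo I M :=
  (flat_quotient_tensor_iff I).1 inferInstance

/-- If every element of a Noetherian `R`-algebra `A` has a topological expansion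
`∑ α, c α f • e α` with coefficients in `R` with respect to the powers of an ideal contained in
the Jacobson radical, then `A` is flat over `R`. -/
theorem Module.Flat.of_expansion [IsNoetherianRing R] [IsNoetherianRing A] {ι : Type*}
    (c : ι → A →ₗ[R] R) (e : ι → A) (s : ℕ → Finset ι) (Q : Ideal A)
    (hQ : Q ≤ Ideal.jacobson ⊥) (h : ∀ f k, f - ∑ α ∈ s k, c α f • e α ∈ Q ^ k) :
    Module.Flat R A := by
  rw [Module.Flat.iff_forall_isTrivialRelation]
  intro l a f haf
  let S : Submodule R (Fin l → R) := LinearMap.ker (∑ i, a i • (LinearMap.proj i : (Fin l → R) →ₗ[R] R))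
  have hS : ∀ r, r ∈ S ↔ ∑ i, a i * r i = 0 := fun r => by
    simp [S]
  let φ : (Fin l → R) → (Fin l → A) := fun r i => algebraMap R A (r i)
  let N : Submodule A (Fin l → A) := Submodule.span A (φ '' S)
  -- Applying the R-linear c α to the relation shows that each vector (c α (f i))_i is a relation
  -- over R. So f lies in N + Q^k A^l for all k, and Krull's theorem gives f ∈ N. A finite
  -- generating set of S then supplies the trivialization.
  have hf : f ∈ N := by
    suffices N.mkQ f = 0 by simpa using this
    rw [← Submodule.mem_bot A, ← Ideal.iInf_pow_smul_eq_bot_of_le_jacobson _ hQ, Submodule.mem_iInf]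
    intro k
    have hdec : f = (fun i => f i - ∑ α ∈ s k, c α (f i) • e α) +
        ∑ α ∈ s k, e α • φ (fun i => c α (f i)) := by
      ext i
      simp [φ, Algebra.smul_def, mul_comm]
    have h2 : N.mkQ (∑ α ∈ s k, e α • φ (fun i => c α (f i))) = 0 := by
      refine (Submodule.Quotient.mk_eq_zero N).2 (sum_mem fun α _ => Submodule.smul_mem _ _ (Submodule.subset_span ⟨_, ?_, rfl⟩))
      rw [SetLike.mem_coe, hS]
      have := congrArg (c α) haf
      simpa using this
    rw [hdec, map_add, h2, add_zero]
    refine Submodule.smul_top_le_comap_smul_top _ N.mkQ ?_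
    generalize hu : (fun i => f i - ∑ α ∈ s k, c α (f i) • e α) = u
    rw [pi_eq_sum_univ' u]
    exact sum_mem fun i _ => Submodule.smul_mem_smul (by rw [← hu]; exact h (f i) k) trivial
  obtain ⟨p, t, ht⟩ := Submodule.fg_iff_exists_fin_generating_family.1
    (IsNoetherian.noetherian S)
  have hN : N ≤ Submodule.span A (Set.range (φ ∘ t)) := by
    refine Submodule.span_le.2 ?_
    rintro _ ⟨r, hr, rfl⟩
    rw [SetLike.mem_coe, ← ht] at hr
    obtain ⟨d, rfl⟩ := (Submodule.mem_span_range_iff_exists_fun R).1 hr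
    have : φ (∑ j, d j • t j) = ∑ j, algebraMap R A (d j) • φ (t j) := by
      ext i
      simp [φ, Algebra.smul_def]
    rw [SetLike.mem_coe, this]
    exact sum_mem fun j _ => Submodule.smul_mem _ _ (Submodule.subset_span ⟨j, rfl⟩)
  obtain ⟨y, hy⟩ := (Submodule.mem_span_range_iff_exists_fun A).1 (hN hf)
  refine ⟨p, fun i j => t j i, y, fun i => ?_, fun j => (hS _).1 ?_⟩
  · rw [← hy]
    simp [φ, Algebra.smul_def, mul_comm]
  · rw [← ht]
    exact Submodule.subset_span ⟨j, rfl⟩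

/-! ### Independence modulo a prime and annihilation of the cokernel -/

/-- A maximal subfamily of generators that is independent modulo a prime ideal `P`. -/
theorem exists_linear_map_independent_modulo_prime (P : Ideal A) [P.IsPrime] (F : Type*)
    [AddCommGroup F] [Module A F] [Module.Finite A F] :
    ∃ (l : ℕ) (ψ : (Fin l → A) →ₗ[A] F) (a : A),
      (∀ v, ψ v ∈ (P • ⊤ : Submodule A F) → ∀ i, v i ∈ P) ∧ a ∉ P ∧
      ∀ f, a • f ∈ LinearMap.range ψ ⊔ (P • ⊤ : Submodule A F) := by
  classical
  obtain ⟨G, hG⟩ := Module.Finite.fg_top (R := A) (M := F)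
  let indep : Finset F → Prop := fun B => ∀ c : F → A,
    ∑ b ∈ B, c b • b ∈ (P • ⊤ : Submodule A F) → ∀ b ∈ B, c b ∈ P
  obtain ⟨B, hBG, hmax⟩ : ∃ B ∈ G.powerset.filter indep, ∀ B' ∈ G.powerset.filter indep,
      B'.card ≤ B.card :=
    Finset.exists_max_image _ _ ⟨∅, by simp [indep]⟩
  rw [Finset.mem_filter, Finset.mem_powerset] at hBG
  obtain ⟨hBG, hB⟩ := hBG
  let U : Submodule A F := Submodule.span A (B : Set F) ⊔ P • ⊤
  have hgen : ∀ h ∈ G, ∃ a : A, a ∉ P ∧ a • h ∈ U := by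
    intro h hh
    by_cases hhB : h ∈ B
    · exact ⟨1, (Ideal.ne_top_iff_one P).1 (Ideal.IsPrime.ne_top ‹_›),
        by simpa using Submodule.mem_sup_left (Submodule.subset_span hhB)⟩
    have hnot : ¬ indep (insert h B) := fun hi => by
      have := hmax (insert h B) (by
        rw [Finset.mem_filter, Finset.mem_powerset]
        exact ⟨Finset.insert_subset hh hBG, hi⟩)
      rw [Finset.card_insert_of_notMem hhB] at this
      omega
    simp only [indep, not_forall] at hnot
    obtain ⟨c, hc, b, hb, hcb⟩ := hnot
    rw [Finset.sum_insert hhB] at hc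
    -- If c h were in P, the term c h • h could be dropped, and independence of B would put all the
    -- other coefficients in P.
    have hch : c h ∉ P := by
      intro hch
      rw [Submodule.add_mem_iff_right _
        (Submodule.smul_mem_smul hch (Submodule.mem_top (x := h)))] at hc
      rcases Finset.mem_insert.1 hb with rfl | hb
      · exact hcb hch
      · exact hcb (hB c hc b hb)
    refine ⟨c h, hch, ?_⟩
    rw [← Submodule.add_mem_iff_left U (y := ∑ b ∈ B, c b • b)]
    · exact Submodule.mem_sup_right hc
    · exact Submodule.mem_sup_left
        (sum_mem fun b hb => Submodule.smul_mem _ _ (Submodule.subset_span hb))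
  choose! a ha haU using hgen
  have hprod : ∏ h ∈ G, a h ∉ P := by
    rw [Ideal.IsPrime.prod_mem_iff]
    push Not
    exact ha
  let ev : Fin B.card ≃ B := B.equivFin.symm
  let ψ : (Fin B.card → A) →ₗ[A] F := Fintype.linearCombination A fun i => (ev i : F)
  have hrange : LinearMap.range ψ = Submodule.span A (B : Set F) := by
    rw [Fintype.range_linearCombination]
    congr 1
    ext x
    constructor
    · rintro ⟨i, rfl⟩
      exact (ev i).2
    · intro hx
      exact ⟨ev.symm ⟨x, hx⟩, by simp⟩
  refine ⟨B.card, ψ, ∏ h ∈ G, a h, fun v hv i => ?_, hprod, fun f => ?_⟩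
  · have key := hB (fun x => if hx : x ∈ B then v (ev.symm ⟨x, hx⟩) else 0) (by
      convert hv using 1
      rw [Fintype.linearCombination_apply, ← Finset.sum_coe_sort B, ← Equiv.sum_comp ev]
      simp) (ev i) (ev i).2
    simpa using key
  · rw [hrange]
    have : (⊤ : Submodule A F) ≤ U.comap (LinearMap.lsmul A F (∏ h ∈ G, a h)) := by
      rw [← hG, Submodule.span_le]
      intro h hh
      rw [SetLike.mem_coe, Submodule.mem_comap, LinearMap.lsmul_apply,
        ← Finset.prod_erase_mul _ _ hh, mul_smul]
      exact Submodule.smul_mem _ _ (haU h hh)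
    exact this trivial

/-- If `a • C ⊆ P • C` then some `g` congruent to a power of `a` modulo `P` annihilates `C`. -/
theorem exists_smul_eq_zero_of_smul_mem (P : Ideal A) [P.IsPrime] {C : Type*} [AddCommGroup C]
    [Module A C] [Module.Finite A C] {a : A} (ha : a ∉ P)
    (haC : ∀ x : C, a • x ∈ (P • ⊤ : Submodule A C)) :
    ∃ g : A, g ∉ P ∧ ∀ x : C, g • x = 0 := by
  -- Cayley–Hamilton: multiplication by a satisfies a monic p whose lower coefficients lie in P.
  -- Thus p(a) kills C and is congruent to a power of a modulo P.
  obtain ⟨p, hp, -, hcoeff, hpa⟩ :=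
    LinearMap.exists_monic_and_natDegree_eq_and_coeff_mem_pow_and_aeval_eq_zero A
      (LinearMap.lsmul A C a) P (by rintro _ ⟨x, rfl⟩; exact haC x)
  refine ⟨p.eval a, fun hmem => ha ?_, fun x => ?_⟩
  · rw [Polynomial.eval_eq_sum_range, Finset.sum_range_succ, hp.coeff_natDegree, one_mul] at hmem
    refine Ideal.IsPrime.mem_of_pow_mem ‹_› _ ((Ideal.add_mem_iff_right _ (sum_mem ?_)).1 hmem)
    intro i hi
    rw [Finset.mem_range] at hi
    exact Ideal.mul_mem_right _ _ (Ideal.pow_le_self (by omega) (hcoeff i))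
  · have h1 : LinearMap.lsmul A C a = algebraMap A (Module.End A C) a := rfl
    rw [h1, Polynomial.aeval_algebraMap_apply] at hpa
    have := LinearMap.congr_fun hpa x
    simpa using this

end LocalCriterion

/-! ### Sizes of monomials and weighted ℓ¹ norms -/

/-- An injective multiplicative size function on exponents, with values in the natural numbers.
It provides both a well-ordering of the monomials and a family of weights. -/
structure ExponentSize (σ : Type*) where
  toFun : (σ →₀ ℕ) → ℕ
  injective : Function.Injective toFun
  map_add : ∀ a b, toFun (a + b) = toFun a * toFun b
  two_pow_le : ∀ a, 2 ^ a.degree ≤ toFun a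
  base : ℕ
  base_pos : 0 < base
  le_base_pow : ∀ a, toFun a ≤ base ^ a.degree

namespace ExponentSize

variable {σ : Type*}

/-- The size `α ↦ ∏ i, p i ^ α i` for distinct primes `p i`. -/
theorem nonempty (σ : Type*) [Finite σ] : Nonempty (ExponentSize σ) := by
  have := Fintype.ofFinite σ
  obtain ⟨p⟩ : Nonempty (σ ↪ Nat.Primes) :=
    ⟨(Fintype.equivFin σ).toEmbedding.trans (Fin.valEmbedding.trans (Infinite.natEmbedding _))⟩
  have hp : ∀ i, (p i : ℕ).Prime := fun i => (p i).2
  have hfac : ∀ (a : σ →₀ ℕ) (j : σ), (∏ i, (p i : ℕ) ^ a i).factorization (p j) = a j := by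
    intro a j
    rw [Nat.factorization_prod fun i _ => pow_ne_zero _ (hp i).ne_zero, Finsupp.finsetSum_apply,
      Finset.sum_eq_single j]
    · simp [(hp j).factorization]
    · intro i _ hij
      have : (p i : ℕ) ≠ p j := fun h => hij (p.injective (Subtype.ext h))
      simp [(hp i).factorization, this]
    · simp
  -- Unique factorization makes the size injective. The base is a crude common bound for the p i;
  -- the added 1 keeps it positive when σ is empty.
  refine ⟨⟨fun a => ∏ i, (p i : ℕ) ^ a i, fun a b hab => ?_, fun a b => ?_, fun a => ?_,
    ∑ i, (p i : ℕ) + 1, by positivity, fun a => ?_⟩⟩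
  · ext j
    rw [← hfac a j, ← hfac b j]
    exact congrArg (fun n : ℕ => n.factorization (p j)) hab
  · simp [pow_add, Finset.prod_mul_distrib]
  · rw [Finsupp.degree_eq_sum, ← Finset.prod_pow_eq_pow_sum]
    exact Finset.prod_le_prod' fun i _ => Nat.pow_le_pow_left (hp i).two_le _
  · rw [Finsupp.degree_eq_sum, ← Finset.prod_pow_eq_pow_sum]
    refine Finset.prod_le_prod' fun i _ => Nat.pow_le_pow_left ?_ _
    exact (Finset.single_le_sum (f := fun i => (p i : ℕ)) (fun _ _ => Nat.zero_le _)
      (Finset.mem_univ i)).trans (Nat.le_succ _)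

variable (ν : ExponentSize σ)

theorem pos (a : σ →₀ ℕ) : 0 < ν.toFun a := (Nat.two_pow_pos _).trans_le (ν.two_pow_le a)

/-- The weight `ν a ^ (-s)`. -/
noncomputable def weight (s : ℕ) (a : σ →₀ ℕ) : ENNReal := ((ν.toFun a : ENNReal)⁻¹) ^ s

theorem weight_add (s : ℕ) (a b : σ →₀ ℕ) :
    ν.weight s (a + b) = ν.weight s a * ν.weight s b := by
  rw [weight, weight, weight, ν.map_add, ← mul_pow, Nat.cast_mul, ENNReal.mul_inv] <;> simp

theorem weight_ne_zero (s : ℕ) (a : σ →₀ ℕ) : ν.weight s a ≠ 0 :=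
  pow_ne_zero _ (ENNReal.inv_ne_zero.2 (ENNReal.natCast_ne_top _))

theorem weight_anti {s t : ℕ} (h : s ≤ t) (a : σ →₀ ℕ) : ν.weight t a ≤ ν.weight s a :=
  pow_le_pow_right_of_le_one' (ENNReal.inv_le_one.2 (by exact_mod_cast ν.pos a)) h

variable {K : Type*} [RCLike K]

/-- The weighted `ℓ¹` norm of a power series. -/
noncomputable def norm (s : ℕ) (f : MvPowerSeries σ K) : ENNReal :=
  ∑' d, ‖MvPowerSeries.coeff d f‖ₑ * ν.weight s d

theorem norm_anti {s t : ℕ} (h : s ≤ t) (f : MvPowerSeries σ K) : ν.norm t f ≤ ν.norm s f :=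
  ENNReal.tsum_le_tsum fun d => mul_le_mul_right (ν.weight_anti h d) _

theorem norm_zero (s : ℕ) : ν.norm s (0 : MvPowerSeries σ K) = 0 := by
  simp [norm]

theorem norm_add_le (s : ℕ) (f g : MvPowerSeries σ K) :
    ν.norm s (f + g) ≤ ν.norm s f + ν.norm s g := by
  rw [norm, norm, norm, ← ENNReal.tsum_add]
  refine ENNReal.tsum_le_tsum fun d => ?_
  rw [← add_mul, _root_.map_add]
  exact mul_le_mul_left (enorm_add_le _ _) _

theorem norm_sum_le {ι : Type*} (s : ℕ) (t : Finset ι) (f : ι → MvPowerSeries σ K) :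
    ν.norm s (∑ i ∈ t, f i) ≤ ∑ i ∈ t, ν.norm s (f i) := by
  classical
  induction t using Finset.induction_on with
  | empty => simp [norm_zero]
  | insert i t hi ih =>
    rw [Finset.sum_insert hi, Finset.sum_insert hi]
    exact (ν.norm_add_le s _ _).trans (by gcongr)

theorem norm_mul_le (s : ℕ) (f g : MvPowerSeries σ K) :
    ν.norm s (f * g) ≤ ν.norm s f * ν.norm s g := by
  classical
  rw [norm, norm, norm, ← ENNReal.tsum_mul_right]
  simp_rw [← ENNReal.tsum_mul_left]
  rw [← ENNReal.tsum_prod, ← Finset.HasAntidiagonal.sigmaAntidiagonalEquivProd.tsum_eq, ENNReal.tsum_sigma']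
  refine ENNReal.tsum_le_tsum fun d => ?_
  rw [tsum_fintype, MvPowerSeries.coeff_mul]
  refine (mul_le_mul_left (enorm_sum_le _ _) _).trans ?_
  rw [Finset.sum_mul, ← Finset.sum_coe_sort]
  refine Finset.sum_le_sum fun p _ => le_of_eq ?_
  have hw : ν.weight s d = ν.weight s p.1.1 * ν.weight s p.1.2 := by
    rw [← weight_add, Finset.HasAntidiagonal.mem_antidiagonal.1 p.2]
  rw [enorm_mul, hw]
  simp only [Finset.HasAntidiagonal.sigmaAntidiagonalEquivProd_apply]
  ring

/-- The size of d lies between 2 ^ d.degree and base ^ d.degree, so the weights ν d ^ (-s) and the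
radii r ^ d.degree dominate one another for suitable s and r. -/
theorem exists_norm_ne_top_iff (f : MvPowerSeries σ K) :
    (∃ s, ν.norm s f ≠ ⊤) ↔ IsConvergentSeries f := by
  constructor
  · rintro ⟨s, hs⟩
    have hb : (0 : ℝ) < ν.base := by exact_mod_cast ν.base_pos
    refine ⟨((ν.base : ℝ)⁻¹) ^ s, by positivity,
      (ENNReal.summable_toReal hs).of_nonneg_of_le (fun d => by positivity) fun d => ?_⟩
    rw [ENNReal.toReal_mul, toReal_enorm, weight, ENNReal.toReal_pow, ENNReal.toReal_inv,
      ENNReal.toReal_natCast, ← pow_mul, mul_comm s, pow_mul, inv_pow]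
    have h1 : (0 : ℝ) < ν.toFun d := by exact_mod_cast ν.pos d
    have h2 : (ν.toFun d : ℝ) ≤ (ν.base : ℝ) ^ d.degree := by exact_mod_cast ν.le_base_pow d
    gcongr
  · rintro ⟨r, hr, hf⟩
    obtain ⟨s, hs⟩ := exists_pow_lt_of_lt_one hr (show (2 : ℝ)⁻¹ < 1 by norm_num)
    refine ⟨s, ne_top_of_le_ne_top hf.tsum_ofReal_ne_top (ENNReal.tsum_le_tsum fun d => ?_)⟩
    have h1 : (0 : ℝ) < ν.toFun d := by exact_mod_cast ν.pos d
    have h2 : (2 : ℝ) ^ d.degree ≤ ν.toFun d := by exact_mod_cast ν.two_pow_le d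
    have h3 : ν.weight s d = ENNReal.ofReal (((ν.toFun d : ℝ)⁻¹) ^ s) := by
      rw [weight, ENNReal.ofReal_pow (by positivity), ENNReal.ofReal_inv_of_pos h1,
        ENNReal.ofReal_natCast]
    rw [h3, ← ofReal_norm, ← ENNReal.ofReal_mul (norm_nonneg _)]
    refine ENNReal.ofReal_le_ofReal (mul_le_mul_of_nonneg_left ?_ (norm_nonneg _))
    calc ((ν.toFun d : ℝ)⁻¹) ^ s ≤ (((2 : ℝ) ^ d.degree)⁻¹) ^ s := by gcongr
      _ = ((2 : ℝ)⁻¹ ^ s) ^ d.degree := by rw [← inv_pow, ← pow_mul, ← pow_mul, mul_comm]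
      _ ≤ r ^ d.degree := by gcongr

/-- The norm of a series all of whose exponents are larger than `a` is eventually negligible
with respect to the weight of `a`. -/
theorem eventually_norm_le_mul_weight {f : MvPowerSeries σ K} (hf : IsConvergentSeries f)
    {a : σ →₀ ℕ} (ha : ∀ d, MvPowerSeries.coeff d f ≠ 0 → ν.toFun a < ν.toFun d) {ε : ENNReal}
    (hε : 0 < ε) : ∀ᶠ s in Filter.atTop, ν.norm s f ≤ ε * ν.weight s a := by
  obtain ⟨s₀, hs₀⟩ := (ν.exists_norm_ne_top_iff f).2 hf
  let x : ENNReal := ν.toFun a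
  have hx0 : x ≠ 0 := by simpa [x] using (ν.pos a).ne'
  have hxt : x ≠ ⊤ := ENNReal.natCast_ne_top _
  -- Sizes are integers, so every exponent of f has size at least x + 1. Raising s by one therefore
  -- gains at least the factor x / (x + 1) over the weight of a.
  have hlt : x * (x + 1)⁻¹ < 1 := by
    rw [← div_eq_mul_inv]
    refine ENNReal.div_lt_of_lt_mul ?_
    rw [one_mul]
    exact ENNReal.lt_add_right hxt one_ne_zero
  have hlim := ENNReal.Tendsto.const_mul (a := ν.norm s₀ f * x ^ s₀)
    (ENNReal.tendsto_pow_atTop_nhds_zero_of_lt_one hlt)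
    (Or.inr (ENNReal.mul_ne_top hs₀ (ENNReal.pow_ne_top hxt)))
  rw [mul_zero] at hlim
  have hev := (hlim.eventually (gt_mem_nhds hε))
  rw [Filter.eventually_atTop] at hev ⊢
  obtain ⟨k₀, hk₀⟩ := hev
  refine ⟨s₀ + k₀, fun s hs => ?_⟩
  obtain ⟨k, rfl⟩ : ∃ k, s = s₀ + k := ⟨s - s₀, by omega⟩
  have hk := (hk₀ k (by omega)).le
  have h1 : ν.norm (s₀ + k) f ≤ ν.norm s₀ f * ((x + 1)⁻¹) ^ k := by
    rw [norm, norm, ← ENNReal.tsum_mul_right]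
    refine ENNReal.tsum_le_tsum fun d => ?_
    by_cases hd : MvPowerSeries.coeff d f = 0
    · simp [hd]
    rw [mul_assoc]
    refine mul_le_mul_right ?_ _
    rw [weight, weight, pow_add]
    refine mul_le_mul_right (pow_le_pow_left' (ENNReal.inv_le_inv.2 ?_) k) _
    have := ha d hd
    simp only [x]
    exact_mod_cast this
  calc ν.norm (s₀ + k) f ≤ ν.norm s₀ f * ((x + 1)⁻¹) ^ k := h1
    _ = ν.norm s₀ f * x ^ s₀ * (x * (x + 1)⁻¹) ^ k * (x⁻¹) ^ (s₀ + k) := by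
      have h2 : x ^ (s₀ + k) * (x⁻¹) ^ (s₀ + k) = 1 := by
        rw [← mul_pow, ENNReal.mul_inv_cancel hx0 hxt, one_pow]
      calc _ = ν.norm s₀ f * ((x + 1)⁻¹) ^ k * (x ^ (s₀ + k) * (x⁻¹) ^ (s₀ + k)) := by
            rw [h2, mul_one]
        _ = _ := by rw [mul_pow x, pow_add x]; ring
    _ ≤ ε * ν.weight (s₀ + k) a := mul_le_mul_left hk _

end ExponentSize

/-! ### The division theorem -/

section Division

open MvPowerSeries

variable {K : Type*} [RCLike K] {σ : Type*}

/-- The part of a power series whose exponents `d` satisfy `c d = j`, divided by `z ^ a`. -/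
noncomputable def shiftedPart {ι : Type*} [DecidableEq ι] (c : (σ →₀ ℕ) → ι) (j : ι) (a : σ →₀ ℕ) :
    MvPowerSeries σ K →ₗ[K] MvPowerSeries σ K where
  toFun h := fun d => if c (d + a) = j then coeff (d + a) h else 0
  map_add' f g := by
    ext d
    change (if c (d + a) = j then coeff (d + a) (f + g) else 0) =
      (if c (d + a) = j then coeff (d + a) f else 0) +
        (if c (d + a) = j then coeff (d + a) g else 0)
    split_ifs <;> simp
  map_smul' r f := by
    ext d
    change (if c (d + a) = j then coeff (d + a) (r • f) else 0) =
      r * (if c (d + a) = j then coeff (d + a) f else 0)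
    split_ifs <;> simp

theorem coeff_shiftedPart {ι : Type*} [DecidableEq ι] (c : (σ →₀ ℕ) → ι) (j : ι) (a : σ →₀ ℕ)
    (h : MvPowerSeries σ K) (d : σ →₀ ℕ) :
    coeff d (shiftedPart c j a h) = if c (d + a) = j then coeff (d + a) h else 0 :=
  rfl

/-- Multiplication by z^a puts the selected coefficients back at their original exponents, where
they form part of h; weights are multiplicative. -/
theorem ExponentSize.norm_shiftedPart_mul_weight_le (ν : ExponentSize σ) {ι : Type*}
    [DecidableEq ι] (c : (σ →₀ ℕ) → ι) (j : ι) (a : σ →₀ ℕ) (s : ℕ) (h : MvPowerSeries σ K) :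
    ν.norm s (shiftedPart c j a h) * ν.weight s a ≤ ν.norm s h := by
  rw [norm, norm, ← ENNReal.tsum_mul_right]
  refine le_trans (ENNReal.tsum_le_tsum fun d => ?_)
    (ENNReal.tsum_comp_le_tsum_of_injective (add_left_injective a) _)
  rw [coeff_shiftedPart, mul_assoc, ← ν.weight_add]
  refine mul_le_mul_left ?_ _
  split_ifs <;> simp

/-- **Division theorem** for convergent power series. -/
theorem exists_division [Finite σ] (ν : ExponentSize σ) {ι : Type*} [Fintype ι]
    (a : ι → σ →₀ ℕ) (g : ι → MvPowerSeries σ K) (hg : ∀ i, IsConvergentSeries (g i))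
    (hga : ∀ i, coeff (a i) (g i) = 1)
    (hlt : ∀ i d, coeff d (g i) ≠ 0 → d = a i ∨ ν.toFun (a i) < ν.toFun d)
    (f : MvPowerSeries σ K) (hf : IsConvergentSeries f) :
    ∃ (Q : ι → MvPowerSeries σ K) (r : MvPowerSeries σ K), (∀ i, IsConvergentSeries (Q i)) ∧
      IsConvergentSeries r ∧ f = ∑ i, Q i * g i + r ∧ ∀ i d, a i ≤ d → coeff d r = 0 := by
  classical
  -- Each exponent is assigned to one leading exponent dividing it, or to the remainder if there is
  -- none.
  obtain ⟨c, hc, hcn⟩ : ∃ c : (σ →₀ ℕ) → Option ι, (∀ d i, c d = some i → a i ≤ d) ∧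
      ∀ d i, a i ≤ d → c d ≠ none := by
    refine ⟨fun d => if h : ∃ i, a i ≤ d then some h.choose else none, fun d i hd => ?_,
      fun d i hd => ?_⟩
    · by_cases h : ∃ i, a i ≤ d
      · simp only at hd
        rw [dif_pos h, Option.some.injEq] at hd
        exact hd ▸ h.choose_spec
      · simp [dif_neg h] at hd
    · have h : ∃ i, a i ≤ d := ⟨i, hd⟩
      simp [h]
  let q : ι → MvPowerSeries σ K →ₗ[K] MvPowerSeries σ K := fun i => shiftedPart c (some i) (a i)
  let rem : MvPowerSeries σ K →ₗ[K] MvPowerSeries σ K := shiftedPart c none 0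
  have hdec : ∀ h, h = ∑ i, q i h * monomial (a i) 1 + rem h := by
    intro h
    ext d
    rw [_root_.map_add, map_sum, coeff_shiftedPart, add_zero]
    have hterm : ∀ i, coeff d (q i h * monomial (a i) 1) =
        if c d = some i then coeff d h else 0 := by
      intro i
      rw [coeff_mul_monomial]
      by_cases hi : a i ≤ d
      · rw [if_pos hi, mul_one, coeff_shiftedPart, tsub_add_cancel_of_le hi]
      · rw [if_neg hi, if_neg fun hci => hi (hc d i hci)]
    simp_rw [hterm]
    cases hcd : c d <;> simp
  -- D is the error made by dividing by the leading monomials instead of the g i. A solution of h -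
  -- D h = f gives f = ∑ q i h * g i + rem h, so 1 - D has to be inverted by a Neumann series.
  let D : MvPowerSeries σ K →ₗ[K] MvPowerSeries σ K :=
    ∑ i, (LinearMap.mulRight K (monomial (a i) 1 - g i)).comp (q i)
  have hD : ∀ h, D h = ∑ i, q i h * (monomial (a i) 1 - g i) := fun h => by simp [D]
  have htail : ∀ i d, coeff d (monomial (a i) 1 - g i) ≠ 0 → ν.toFun (a i) < ν.toFun d := by
    intro i d hd
    by_cases hda : d = a i
    · subst hda
      simp [hga] at hd
    · rw [map_sub, coeff_monomial, if_neg hda, zero_sub, neg_ne_zero] at hd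
      exact (hlt i d hd).resolve_left hda
  have hraise : ∀ k h, (∀ d, ν.toFun d < k → coeff d h = 0) →
      ∀ d, ν.toFun d < k + 1 → coeff d (D h) = 0 := by
    intro k h hk d hd
    rw [hD, map_sum]
    refine Finset.sum_eq_zero fun i _ => ?_
    rw [coeff_mul]
    refine Finset.sum_eq_zero fun p hp => ?_
    by_contra hne
    have h1 := htail i p.2 (right_ne_zero_of_mul hne)
    have h2 := left_ne_zero_of_mul hne
    rw [coeff_shiftedPart] at h2
    refine h2 ?_
    split_ifs with h3
    · apply hk
      rw [← Finset.HasAntidiagonal.mem_antidiagonal.1 hp, ν.map_add] at hd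
      rw [ν.map_add]
      have := Nat.mul_lt_mul_of_pos_left h1 (ν.pos p.1)
      omega
    · rfl
  have hpow : ∀ j d, ν.toFun d < j → coeff d ((D ^ j) f) = 0 := by
    intro j
    induction j with
    | zero => intro d hd; omega
    | succ j ih =>
      rw [pow_succ']
      exact hraise j _ ih
  -- The Neumann series ∑ D^j f. Since D^j f has no exponent of size below j, only the terms j ≤ ν d
  -- contribute at d, the last one being j = ν d.
  let h : MvPowerSeries σ K := fun d => coeff d (∑ j ∈ Finset.range (ν.toFun d), (D ^ j) f) +
    coeff d ((D ^ ν.toFun d) f)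
  have hcoeff : ∀ d, coeff d h = ∑ j ∈ Finset.range (ν.toFun d + 1), coeff d ((D ^ j) f) := by
    intro d
    rw [Finset.sum_range_succ, ← map_sum]
    rfl
  have hpartial : ∀ M d, ν.toFun d < M →
      coeff d (h - ∑ j ∈ Finset.range M, (D ^ j) f) = 0 := by
    intro M d hd
    rw [map_sub, hcoeff, map_sum, sub_eq_zero]
    refine Finset.sum_subset (Finset.range_mono hd) fun j _ hj => hpow j d ?_
    simpa using hj
  have hfix : h - D h = f := by
    ext d
    let M := ν.toFun d + 1
    let S := ∑ j ∈ Finset.range M, (D ^ j) f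
    have h1 : coeff d (h - S) = 0 := hpartial M d (Nat.lt_succ_self _)
    have h2 : coeff d (D (h - S)) = 0 := hraise M _ (hpartial M) d (by omega)
    have h3 : S - D S = f - (D ^ M) f := by
      have := Finset.sum_range_sub' (fun j => (D ^ j) f) M
      simp only [S, map_sum]
      rw [← Finset.sum_sub_distrib]
      simpa [pow_succ'] using this
    have h4 : coeff d ((D ^ M) f) = 0 := hpow M d (Nat.lt_succ_self _)
    have h5 : h - D h = (h - S) - D (h - S) + (S - D S) := by
      rw [map_sub]; abel
    rw [h5, h3, _root_.map_add, map_sub _ (h - S), map_sub _ f, h1, h2, h4]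
    simp
  obtain ⟨s, hsf, hsD⟩ : ∃ s, ν.norm s f ≠ ⊤ ∧ ∀ u, ν.norm s (D u) ≤ 2⁻¹ * ν.norm s u := by
    -- With this ε the errors of all the i add up to at most half the norm, so D contracts and the
    -- series converges. For empty ι, ε = ⊤ is harmless because the sum is empty.
    let ε : ENNReal := 2⁻¹ * (Fintype.card ι : ENNReal)⁻¹
    have hε : 0 < ε := ENNReal.mul_pos (by simp) (by simp)
    obtain ⟨s₀, hs₀⟩ := (ν.exists_norm_ne_top_iff f).2 hf
    have hev : ∀ᶠ s in Filter.atTop, ∀ i, ν.norm s (monomial (a i) 1 - g i) ≤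
        ε * ν.weight s (a i) := by
      refine Filter.eventually_all.2 fun i => ν.eventually_norm_le_mul_weight ?_ (htail i) hε
      exact (convergentSubalgebra K σ).sub_mem (IsConvergentSeries.monomial _ _) (hg i)
    obtain ⟨s, hs, hss₀⟩ := (hev.and (Filter.eventually_ge_atTop s₀)).exists
    refine ⟨s, ne_top_of_le_ne_top hs₀ (ν.norm_anti hss₀ f), fun u => ?_⟩
    rw [hD]
    calc ν.norm s (∑ i, q i u * (monomial (a i) 1 - g i))
        ≤ ∑ i, ν.norm s (q i u * (monomial (a i) 1 - g i)) := ν.norm_sum_le s _ _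
      _ ≤ ∑ _i : ι, ε * ν.norm s u := Finset.sum_le_sum fun i _ => by
          refine (ν.norm_mul_le s _ _).trans ((mul_le_mul_right (hs i) _).trans ?_)
          rw [mul_left_comm]
          exact mul_le_mul_right (ν.norm_shiftedPart_mul_weight_le c (some i) (a i) s u) _
      _ ≤ 2⁻¹ * ν.norm s u := by
          rw [Finset.sum_const, nsmul_eq_mul, Finset.card_univ, ← mul_assoc]
          refine mul_le_mul_left ?_ _
          rw [mul_left_comm]
          exact mul_le_of_le_one_right' (ENNReal.mul_inv_le_one _)
  have hiter : ∀ j, ν.norm s ((D ^ j) f) ≤ 2⁻¹ ^ j * ν.norm s f := by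
    intro j
    induction j with
    | zero => simp
    | succ j ih =>
      rw [pow_succ', pow_succ', mul_assoc]
      exact (hsD _).trans (mul_le_mul_right ih _)
  have hh : IsConvergentSeries h := by
    refine (ν.exists_norm_ne_top_iff h).1 ⟨s, ne_top_of_le_ne_top ?_
      (?_ : _ ≤ ∑' j : ℕ, 2⁻¹ ^ j * ν.norm s f)⟩
    · rw [ENNReal.tsum_mul_right]
      exact ENNReal.mul_ne_top (by simp [ENNReal.tsum_geometric]) hsf
    · refine le_trans ?_ (ENNReal.tsum_le_tsum hiter)
      simp only [ExponentSize.norm]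
      rw [ENNReal.tsum_comm]
      refine ENNReal.tsum_le_tsum fun d => ?_
      rw [ENNReal.tsum_mul_right]
      refine mul_le_mul_left ?_ _
      rw [hcoeff]
      exact (enorm_sum_le _ _).trans (ENNReal.sum_le_tsum _)
  have hpart : ∀ (j : Option ι) (b : σ →₀ ℕ), IsConvergentSeries (shiftedPart c j b h) := by
    intro j b
    obtain ⟨s, hs⟩ := (ν.exists_norm_ne_top_iff h).2 hh
    refine (ν.exists_norm_ne_top_iff _).1 ⟨s, fun htop => ?_⟩
    have := ν.norm_shiftedPart_mul_weight_le c j b s h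
    rw [htop, ENNReal.top_mul (ν.weight_ne_zero s b)] at this
    exact hs (top_le_iff.1 this)
  refine ⟨fun i => q i h, rem h, fun i => hpart _ _, hpart _ _, ?_, fun i d hi => ?_⟩
  · rw [← hfix, hD]
    conv_lhs => enter [1]; rw [hdec h]
    simp only [mul_sub, Finset.sum_sub_distrib]
    abel
  · rw [coeff_shiftedPart, if_neg]
    simpa using hcn d i hi

end Division

/-! ### Convergent power series rings are Noetherian and local -/

namespace ConvergentPowerSeries

variable {K : Type*} [RCLike K] {σ τ : Type*}

theorem toFormal_injective : Function.Injective (toFormal K σ) := Subtype.val_injective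

instance : IsDomain (ConvergentPowerSeries K σ) :=
  have : IsDomain (MvPowerSeries σ K) := NoZeroDivisors.to_isDomain _
  (toFormal_injective (K := K) (σ := σ)).isDomain (toFormal K σ).toRingHom

/-- A convergent formal power series as an element of `K{z}`. -/
def ofFormal (f : MvPowerSeries σ K) (hf : IsConvergentSeries f) : ConvergentPowerSeries K σ :=
  ⟨f, hf⟩

theorem toFormal_ofFormal (f : MvPowerSeries σ K) (hf : IsConvergentSeries f) :
    toFormal K σ (ofFormal f hf) = f := rfl

/-- The coefficient of a convergent power series at an exponent. -/
noncomputable def coeff (d : σ →₀ ℕ) : ConvergentPowerSeries K σ →ₗ[K] K :=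
  (MvPowerSeries.coeff d).comp (toFormal K σ).toLinearMap

theorem coeff_apply (d : σ →₀ ℕ) (f : ConvergentPowerSeries K σ) :
    coeff d f = MvPowerSeries.coeff d (toFormal K σ f) := rfl

theorem ext_coeff {f g : ConvergentPowerSeries K σ} (h : ∀ d, coeff d f = coeff d g) : f = g :=
  toFormal_injective (MvPowerSeries.ext h)

/-- The monomial `z ^ a`. -/
noncomputable def mono (K : Type*) [RCLike K] (a : σ →₀ ℕ) : ConvergentPowerSeries K σ :=
  ofFormal (MvPowerSeries.monomial a 1) (IsConvergentSeries.monomial a 1)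

theorem toFormal_mono (a : σ →₀ ℕ) : toFormal K σ (mono K a) = MvPowerSeries.monomial a 1 := rfl

theorem mono_zero : mono K (0 : σ →₀ ℕ) = 1 :=
  toFormal_injective (by rw [map_one (toFormal K σ)]; rfl)

theorem mono_add (a b : σ →₀ ℕ) : mono K (a + b) = mono K a * mono K b :=
  toFormal_injective (by simp [toFormal_mono, MvPowerSeries.monomial_mul_monomial])

theorem mono_single (i : σ) : mono K (Finsupp.single i 1) = X i := rfl

theorem coeff_mono [DecidableEq σ] (a d : σ →₀ ℕ) :
    coeff d (mono K a) = if d = a then 1 else 0 := by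
  rw [coeff_apply, toFormal_mono, MvPowerSeries.coeff_monomial]

theorem coeff_mul_mono (a d : σ →₀ ℕ) (f : ConvergentPowerSeries K σ) :
    coeff d (f * mono K a) = if a ≤ d then coeff (d - a) f else 0 := by
  rw [coeff_apply, map_mul, toFormal_mono, MvPowerSeries.coeff_mul_monomial]
  simp [coeff_apply]

theorem coeff_mul [DecidableEq σ] (d : σ →₀ ℕ) (f g : ConvergentPowerSeries K σ) :
    coeff d (f * g) = ∑ p ∈ Finset.HasAntidiagonal.antidiagonal d, coeff p.1 f * coeff p.2 g := by
  rw [coeff_apply, map_mul, MvPowerSeries.coeff_mul]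
  rfl

/-- **Division theorem** in the ring of convergent power series. -/
theorem exists_eq_sum_mul_add [Finite σ] (ν : ExponentSize σ) {ι : Type*} [Fintype ι]
    (a : ι → σ →₀ ℕ) (g : ι → ConvergentPowerSeries K σ) (hga : ∀ i, coeff (a i) (g i) = 1)
    (hlt : ∀ i d, coeff d (g i) ≠ 0 → d = a i ∨ ν.toFun (a i) < ν.toFun d)
    (f : ConvergentPowerSeries K σ) :
    ∃ (Q : ι → ConvergentPowerSeries K σ) (r : ConvergentPowerSeries K σ),
      f = ∑ i, Q i * g i + r ∧ ∀ i d, a i ≤ d → coeff d r = 0 := by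
  obtain ⟨Q, r, hQ, hr, hf, hr0⟩ := exists_division ν a (fun i => toFormal K σ (g i))
    (fun i => (g i).2) hga hlt (toFormal K σ f) f.2
  refine ⟨fun i => ofFormal (Q i) (hQ i), ofFormal r hr, toFormal_injective ?_, hr0⟩
  rw [hf, map_add, map_sum, toFormal_ofFormal]
  simp only [map_mul, toFormal_ofFormal]

/-- Rückert's basis theorem: the ring of convergent power series in finitely many variables is
Noetherian. -/
instance isNoetherianRing [Finite σ] : IsNoetherianRing (ConvergentPowerSeries K σ) := by
  obtain ⟨ν⟩ := ExponentSize.nonempty σ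
  rw [isNoetherianRing_iff_ideal_fg]
  intro I
  let S : (σ →₀ ℕ) → Prop := fun a => ∃ f ∈ I, coeff a f = 1 ∧
    ∀ d, coeff d f ≠ 0 → d = a ∨ ν.toFun a < ν.toFun d
  have hlead : ∀ r ∈ I, r ≠ 0 → ∃ a, S a ∧ coeff a r ≠ 0 := by
    intro r hr hr0
    have hne : {d | coeff d r ≠ 0}.Nonempty := by
      by_contra hempty
      refine hr0 (ext_coeff fun d => ?_)
      by_contra hd
      exact hempty ⟨d, by simpa using hd⟩
    obtain ⟨a, ha, hmin⟩ := (measure ν.toFun).wf.has_min _ hne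
    refine ⟨a, ⟨algebraMap K _ (coeff a r)⁻¹ * r, I.mul_mem_left _ hr, ?_, fun d hd => ?_⟩, ha⟩
    · rw [← Algebra.smul_def, map_smul, smul_eq_mul, inv_mul_cancel₀ ha]
    · rw [← Algebra.smul_def, map_smul, smul_eq_mul] at hd
      have h1 : ¬ ν.toFun d < ν.toFun a := hmin d (right_ne_zero_of_mul hd)
      rcases (not_lt.1 h1).eq_or_lt with h | h
      · exact Or.inl (ν.injective h.symm)
      · exact Or.inr h
  -- Dickson's lemma: the minimal leading exponents of I form an antichain in a well-quasi-order.
  have hfin : {a | Minimal S a}.Finite :=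
    WellQuasiOrderedLE.finite_of_isAntichain (setOfPred_minimal_antichain S)
  have := hfin.fintype
  choose g hgI hga hlt using fun a : {a | Minimal S a} => a.2.prop
  refine Submodule.fg_iff_exists_fin_generating_family.2
    ⟨_, g ∘ (Fintype.equivFin _).symm, ?_⟩
  rw [(Fintype.equivFin _).symm.surjective.range_comp]
  refine le_antisymm (Submodule.span_le.2 ?_) fun f hf => ?_
  · rintro _ ⟨a, rfl⟩
    exact hgI a
  · obtain ⟨Q, r, rfl, hr⟩ := exists_eq_sum_mul_add ν (fun a : {a | Minimal S a} => a.1) g hga hlt f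
    have hsum : ∑ i, Q i * g i ∈ Submodule.span (ConvergentPowerSeries K σ) (Set.range g) :=
      sum_mem fun i _ => Submodule.smul_mem _ _ (Submodule.subset_span ⟨i, rfl⟩)
    have hrI : r ∈ I := by
      refine (Ideal.add_mem_iff_right I (sum_mem fun i _ => ?_)).1 hf
      exact I.mul_mem_left _ (hgI i)
    suffices r = 0 by rwa [this, add_zero]
    -- A nonzero remainder in I would have a leading exponent above some minimal one, exactly where
    -- division makes its coefficients vanish.
    by_contra hr0
    obtain ⟨a, haS, har⟩ := hlead r hrI hr0
    obtain ⟨b, hba, hb⟩ := exists_minimal_le_of_wellFoundedLT S a haS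
    exact har (hr ⟨b, hb⟩ a hba)

/-- Divide f by the monomials themselves. The remainder has no exponent above an a i, while f and
all multiples of the monomials have only such exponents; so it is zero. -/
theorem mem_span_mono [Finite σ] {ι : Type*} [Finite ι] (a : ι → σ →₀ ℕ)
    (f : ConvergentPowerSeries K σ) (hf : ∀ d, coeff d f ≠ 0 → ∃ i, a i ≤ d) :
    f ∈ Ideal.span (Set.range fun i => mono K (a i)) := by
  classical
  have := Fintype.ofFinite ι
  obtain ⟨ν⟩ := ExponentSize.nonempty σ
  obtain ⟨Q, r, rfl, hr⟩ := exists_eq_sum_mul_add ν a (fun i => mono K (a i))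
    (fun i => by simp [coeff_mono]) (fun i d hd => by
      rw [coeff_mono] at hd
      exact Or.inl (by_contra fun h => hd (if_neg h))) f
  suffices r = 0 by
    rw [this, add_zero]
    exact sum_mem fun i _ => Ideal.mul_mem_left _ _ (Ideal.subset_span ⟨i, rfl⟩)
  refine ext_coeff fun d => ?_
  rw [map_zero]
  by_cases hd : ∃ i, a i ≤ d
  · obtain ⟨i, hi⟩ := hd
    exact hr i d hi
  · by_contra hrd
    refine hd (hf d ?_)
    rwa [map_add, map_sum, Finset.sum_eq_zero, zero_add]
    intro i _
    rw [coeff_mul_mono, if_neg fun hi => hd ⟨i, hi⟩]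

/-- Divide 1 by f after normalization: the leading exponent 0 lies below every exponent, so no
remainder is left. -/
theorem isUnit_of_coeff_zero_ne_zero [Finite σ] {f : ConvergentPowerSeries K σ}
    (hf : coeff 0 f ≠ 0) : IsUnit f := by
  obtain ⟨ν⟩ := ExponentSize.nonempty σ
  have hν : ν.toFun 0 = 1 := by
    have h1 := ν.map_add 0 0
    rw [add_zero] at h1
    exact Nat.eq_of_mul_eq_mul_left (ν.pos 0) (by rw [mul_one]; exact h1.symm)
  obtain ⟨Q, r, h1, hr⟩ := exists_eq_sum_mul_add ν (fun _ : Unit => 0)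
    (fun _ => algebraMap K _ (coeff 0 f)⁻¹ * f)
    (fun _ => by rw [← Algebra.smul_def, map_smul, smul_eq_mul, inv_mul_cancel₀ hf])
    (fun _ d _ => by
      rw [or_iff_not_imp_left]
      intro hd
      have h2 : ν.toFun d ≠ ν.toFun 0 := fun h => hd (ν.injective h)
      have h3 := ν.pos d
      omega) 1
  have hr0 : r = 0 := ext_coeff fun d => by rw [hr () d zero_le, map_zero]
  rw [hr0, add_zero, Fintype.sum_unique, ← mul_assoc] at h1
  exact IsUnit.of_mul_eq_one_right _ h1.symm

/-- The constant coefficient as a ring homomorphism. -/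
noncomputable def constantCoeff (K : Type*) [RCLike K] (σ : Type*) :
    ConvergentPowerSeries K σ →+* K :=
  MvPowerSeries.constantCoeff.comp (toFormal K σ).toRingHom

theorem constantCoeff_apply (f : ConvergentPowerSeries K σ) :
    constantCoeff K σ f = coeff 0 f := rfl

instance [Finite σ] : IsLocalHom (constantCoeff K σ) :=
  ⟨fun f hf => isUnit_of_coeff_zero_ne_zero (by simpa [constantCoeff_apply] using hf.ne_zero)⟩

instance [Finite σ] : IsLocalRing (ConvergentPowerSeries K σ) :=
  RingHom.domain_isLocalRing (constantCoeff K σ)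

theorem mem_maximalIdeal_iff [Finite σ] (f : ConvergentPowerSeries K σ) :
    f ∈ IsLocalRing.maximalIdeal (ConvergentPowerSeries K σ) ↔ coeff 0 f = 0 := by
  rw [IsLocalRing.mem_maximalIdeal, mem_nonunits_iff, ← isUnit_map_iff (constantCoeff K σ),
    isUnit_iff_ne_zero, not_not, constantCoeff_apply]

theorem X_mem_maximalIdeal [Finite σ] (i : σ) :
    (X i : ConvergentPowerSeries K σ) ∈ IsLocalRing.maximalIdeal (ConvergentPowerSeries K σ) := by
  classical
  rw [mem_maximalIdeal_iff, ← mono_single, coeff_mono, if_neg]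
  intro h
  have := DFunLike.congr_fun h i
  simp at this

theorem varIdeal_eq_maximalIdeal [Finite σ] :
    varIdeal K σ = IsLocalRing.maximalIdeal (ConvergentPowerSeries K σ) := by
  refine le_antisymm (Ideal.span_le.2 ?_) fun f hf => ?_
  · rintro _ ⟨i, rfl⟩
    exact X_mem_maximalIdeal i
  · refine mem_span_mono (fun i => Finsupp.single i 1) f fun d hd => ?_
    rw [mem_maximalIdeal_iff] at hf
    by_contra! h
    have : d = 0 := by
      ext i
      by_contra hi
      exact h i (Finsupp.single_le_iff.2 (Nat.one_le_iff_ne_zero.2 hi))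
    exact hd (this ▸ hf)

/-! ### Two groups of variables: evaluation at y = 0 and flatness over K{y} -/

/-- The exponent with `y`-part `d` and `x`-part `a`. -/
noncomputable def pairExponent : (σ →₀ ℕ) × (τ →₀ ℕ) ≃+ (σ ⊕ τ →₀ ℕ) :=
  Finsupp.sumFinsuppAddEquivProdFinsupp.symm

@[simp] theorem pairExponent_inl (p : (σ →₀ ℕ) × (τ →₀ ℕ)) (i : σ) :
    pairExponent p (.inl i) = p.1 i := rfl

@[simp] theorem pairExponent_inr (p : (σ →₀ ℕ) × (τ →₀ ℕ)) (i : τ) :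
    pairExponent p (.inr i) = p.2 i := rfl

theorem embDomain_inl_eq (d : σ →₀ ℕ) :
    d.embDomain (Function.Embedding.inl : σ ↪ σ ⊕ τ) = pairExponent (d, 0) := by
  ext (i | i)
  · exact Finsupp.embDomain_apply_self Function.Embedding.inl d i
  · exact Finsupp.embDomain_of_notMem_range _ _ _ (by simp)

theorem embDomain_inr_eq (d : τ →₀ ℕ) :
    d.embDomain (Function.Embedding.inr : τ ↪ σ ⊕ τ) = pairExponent (0, d) := by
  ext (i | i)
  · exact Finsupp.embDomain_of_notMem_range _ _ _ (by simp)
  · exact Finsupp.embDomain_apply_self Function.Embedding.inr d i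

theorem degree_pairExponent (p : (σ →₀ ℕ) × (τ →₀ ℕ)) :
    (pairExponent p).degree = p.1.degree + p.2.degree := by
  have : p = (p.1, 0) + (0, p.2) := by simp
  conv_lhs => rw [this]
  rw [map_add, map_add, ← embDomain_inl_eq, ← embDomain_inr_eq, Finsupp.embDomain_eq_mapDomain,
    Finsupp.embDomain_eq_mapDomain, Finsupp.degree_mapDomain, Finsupp.degree_mapDomain]

theorem coeff_algebraMap (a : ConvergentPowerSeries K σ) (p : (σ →₀ ℕ) × (τ →₀ ℕ))
    [Decidable (p.2 = 0)] :
    coeff (pairExponent p) (algebraMap _ (ConvergentPowerSeries K (σ ⊕ τ)) a) =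
      if p.2 = 0 then coeff p.1 a else 0 := by
  change MvPowerSeries.coeff _ (MvPowerSeries.rename Function.Embedding.inl (toFormal K σ a)) = _
  obtain ⟨d, b⟩ := p
  split_ifs with h
  · obtain rfl : b = 0 := h
    rw [← embDomain_inl_eq, MvPowerSeries.coeff_embDomain_rename]
    rfl
  · rw [MvPowerSeries.coeff_rename_eq_zero]
    rintro ⟨e, he⟩
    refine h ?_
    ext i
    rw [← pairExponent_inr (d, b) i, ← he, Finsupp.mapDomain_of_notMem_range]
    · rfl
    · simp

theorem coeff_evalZero (f : ConvergentPowerSeries K (σ ⊕ τ)) (a : τ →₀ ℕ) :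
    coeff a (evalZero K σ τ f) = coeff (pairExponent (0, a)) f := by
  change MvPowerSeries.coeff a (MvPowerSeries.killCompl _ (toFormal K _ f)) = _
  rw [MvPowerSeries.coeff_killCompl, ← embDomain_inr_eq, Finsupp.embDomain_eq_mapDomain]
  rfl

/-- The kernel of the evaluation at `y = 0` is generated by the variables `y`. -/
theorem ker_evalZero [Finite σ] [Finite τ] : RingHom.ker (evalZero K σ τ) =
    (varIdeal K σ).map (algebraMap _ (ConvergentPowerSeries K (σ ⊕ τ))) := by
  classical
  have hX : ∀ i : σ, algebraMap _ (ConvergentPowerSeries K (σ ⊕ τ)) (X i : ConvergentPowerSeries K σ)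
      = X (.inl i) := fun i => toFormal_injective (MvPowerSeries.rename_X _ i)
  rw [varIdeal, Ideal.map_span, ← Set.range_comp]
  refine le_antisymm (fun f hf => ?_) (Ideal.span_le.2 ?_)
  · have := mem_span_mono (fun i : σ => (Finsupp.single (.inl i) 1 : σ ⊕ τ →₀ ℕ)) f fun d hd => by
      obtain ⟨⟨b, a⟩, rfl⟩ := pairExponent.surjective d
      by_contra! h
      have hb : b = 0 := by
        ext i
        by_contra hi
        exact h i (Finsupp.single_le_iff.2 (Nat.one_le_iff_ne_zero.2 hi))
      subst hb
      rw [← coeff_evalZero, (RingHom.mem_ker).1 hf, map_zero] at hd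
      exact hd rfl
    convert this using 3
    exact funext hX
  · rintro _ ⟨i, rfl⟩
    rw [SetLike.mem_coe, RingHom.mem_ker, Function.comp_apply, hX]
    refine ext_coeff fun a => ?_
    rw [coeff_evalZero, ← mono_single, coeff_mono, if_neg, map_zero]
    intro h
    have := DFunLike.congr_fun h (.inl i)
    simp at this

instance [Finite σ] [Finite τ] : ((varIdeal K σ).map
    (algebraMap _ (ConvergentPowerSeries K (σ ⊕ τ)))).IsPrime :=
  ker_evalZero (K := K) (σ := σ) (τ := τ) ▸ RingHom.ker_isPrime _

theorem map_maximalIdeal_le_jacobson [Finite σ] [Finite τ] :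
    (IsLocalRing.maximalIdeal (ConvergentPowerSeries K σ)).map
      (algebraMap _ (ConvergentPowerSeries K (σ ⊕ τ))) ≤ Ideal.jacobson ⊥ := by
  rw [← varIdeal_eq_maximalIdeal]
  exact (IsLocalRing.le_maximalIdeal (Ideal.IsPrime.ne_top inferInstance)).trans
    (IsLocalRing.maximalIdeal_le_jacobson _)

theorem coeff_algebraMap_mul (r : ConvergentPowerSeries K σ) (f : ConvergentPowerSeries K (σ ⊕ τ))
    (d : σ →₀ ℕ) (a : τ →₀ ℕ) [DecidableEq σ] :
    coeff (pairExponent (d, a)) (algebraMap _ (ConvergentPowerSeries K (σ ⊕ τ)) r * f) =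
      ∑ p ∈ Finset.HasAntidiagonal.antidiagonal d, coeff p.1 r * coeff (pairExponent (p.2, a)) f := by
  classical
  rw [coeff_mul]
  refine (Finset.sum_of_injOn (fun p => (pairExponent (p.1, 0), pairExponent (p.2, a)))
    ?_ ?_ ?_ ?_).symm
  · rintro ⟨p, q⟩ _ ⟨p', q'⟩ _ h
    simpa using h
  · rintro ⟨p, q⟩ h
    rw [SetLike.mem_coe, Finset.HasAntidiagonal.mem_antidiagonal] at h ⊢
    rw [← map_add, ← h]
    simp
  · rintro ⟨u, v⟩ huv hnot
    obtain ⟨⟨p, b⟩, rfl⟩ := pairExponent.surjective u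
    obtain ⟨⟨q, c⟩, rfl⟩ := pairExponent.surjective v
    rw [Finset.HasAntidiagonal.mem_antidiagonal, ← map_add, pairExponent.injective.eq_iff,
      Prod.mk_add_mk, Prod.mk.injEq] at huv
    rw [coeff_algebraMap, if_neg, zero_mul]
    rintro (rfl : b = 0)
    refine hnot ⟨(p, q), ?_, ?_⟩
    · simpa using huv.1
    · obtain rfl : c = a := by simpa using huv.2
      rfl
  · rintro ⟨p, q⟩ _
    rw [coeff_algebraMap, if_pos rfl]

theorem isConvergentSeries_coeff_pair (f : ConvergentPowerSeries K (σ ⊕ τ)) (a : τ →₀ ℕ) :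
    IsConvergentSeries (K := K) (σ := σ) fun d => coeff (pairExponent (d, a)) f := by
  obtain ⟨r, hr, hf⟩ := f.2
  refine ⟨r, hr, ?_⟩
  have hinj : Function.Injective fun d : σ →₀ ℕ => pairExponent (d, a) := fun d d' h => by
    simpa using h
  refine ((hf.comp_injective hinj).mul_right (r ^ a.degree)⁻¹).congr fun d => ?_
  have : r ^ a.degree ≠ 0 := by positivity
  simp only [Function.comp_apply, degree_pairExponent, pow_add]
  rw [← mul_assoc, mul_assoc, mul_inv_cancel₀ this, mul_one]
  rfl

/-- The coefficient of `x ^ a`, a power series in `y`. -/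
noncomputable def coeffX (a : τ →₀ ℕ) :
    ConvergentPowerSeries K (σ ⊕ τ) →ₗ[ConvergentPowerSeries K σ] ConvergentPowerSeries K σ where
  toFun f := ofFormal (fun d => coeff (pairExponent (d, a)) f) (isConvergentSeries_coeff_pair f a)
  map_add' f g := ext_coeff fun d => map_add (coeff (pairExponent (d, a))) f g
  map_smul' r f := ext_coeff fun d => by
    classical
    rw [RingHom.id_apply, smul_eq_mul, coeff_mul]
    change coeff (pairExponent (d, a)) (r • f) = _
    rw [Algebra.smul_def, coeff_algebraMap_mul]
    rfl

theorem coeff_coeffX (f : ConvergentPowerSeries K (σ ⊕ τ)) (d : σ →₀ ℕ) (a : τ →₀ ℕ) :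
    coeff d (coeffX a f) = coeff (pairExponent (d, a)) f := rfl

theorem coeffX_mono [DecidableEq τ] (a b : τ →₀ ℕ) :
    coeffX a (mono K (pairExponent ((0 : σ →₀ ℕ), b))) = if a = b then 1 else 0 := by
  classical
  refine ext_coeff fun d => ?_
  rw [coeff_coeffX, coeff_mono]
  simp only [pairExponent.injective.eq_iff, Prod.mk.injEq]
  by_cases h : a = b
  · rw [if_pos h, ← mono_zero, coeff_mono]
    simp [h]
  · simp [h]

theorem mono_mem_span_X_pow (a : τ →₀ ℕ) :
    mono K (pairExponent ((0 : σ →₀ ℕ), a)) ∈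
      Ideal.span (Set.range fun i : τ => (X (.inr i) : ConvergentPowerSeries K (σ ⊕ τ))) ^
        a.degree := by
  induction a using Finsupp.induction_linear with
  | zero => simp
  | add f g hf hg =>
    have : ((0 : σ →₀ ℕ), f + g) = (0, f) + (0, g) := by simp
    rw [this, map_add pairExponent, mono_add, map_add, pow_add]
    exact Ideal.mul_mem_mul hf hg
  | single i n =>
    induction n with
    | zero => simp
    | succ n ih =>
      have : ((0 : σ →₀ ℕ), Finsupp.single i (n + 1)) =
          (0, Finsupp.single i n) + (0, Finsupp.single i 1) := by simp [Finsupp.single_add]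
      rw [this, map_add pairExponent, mono_add, Finsupp.degree_single, pow_succ]
      rw [Finsupp.degree_single] at ih
      refine Ideal.mul_mem_mul ih (Ideal.subset_span ⟨i, ?_⟩)
      refine (mono_single (K := K) (Sum.inr i : σ ⊕ τ)).symm.trans (congrArg (mono K) ?_)
      classical
      ext (j | j) <;> simp [Finsupp.single_apply]

/-- The ring `K{y, x}` is flat over `K{y}`. -/
instance flat [Finite σ] [Finite τ] :
    Module.Flat (ConvergentPowerSeries K σ) (ConvergentPowerSeries K (σ ⊕ τ)) := by
  classical
  refine Module.Flat.of_expansion coeffX (fun a : τ →₀ ℕ => mono K (pairExponent (0, a)))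
    (fun k => (Finsupp.finite_of_degree_lt k).toFinset)
    (Ideal.span (Set.range fun i : τ => X (.inr i))) ?_ fun f k => ?_
  · refine le_trans (Ideal.span_le.2 ?_) (IsLocalRing.maximalIdeal_le_jacobson _)
    rintro _ ⟨i, rfl⟩
    exact X_mem_maximalIdeal _
  -- Removing the terms of x-degree below k leaves only exponents that dominate some x-exponent of
  -- degree exactly k; there are finitely many of these, so `mem_span_mono` applies.
  · have := (Finsupp.finite_of_degree_eq (σ := τ) k).to_subtype
    refine Ideal.span_le.2 ?_ (mem_span_mono
      (fun a : {a : τ →₀ ℕ | a.degree = k} => pairExponent ((0 : σ →₀ ℕ), a.1)) _ fun d hd => ?_)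
    · rintro _ ⟨⟨a, rfl⟩, rfl⟩
      exact mono_mem_span_X_pow a
    · obtain ⟨⟨b, a⟩, rfl⟩ := pairExponent.surjective d
      have hk : k ≤ a.degree := by
        by_contra! hlt
        refine hd ?_
        rw [← coeff_coeffX, map_sub, map_sum]
        simp only [map_smul, coeffX_mono, smul_eq_mul, mul_ite, mul_one, mul_zero]
        rw [Finset.sum_ite_eq, if_pos (by simpa using hlt), sub_self, map_zero]
      obtain ⟨a', ha', hdeg⟩ := Finsupp.exists_le_degree_eq a k hk
      refine ⟨⟨a', hdeg⟩, ?_⟩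
      rintro (i | i)
      · simp
      · simpa using ha' i

end ConvergentPowerSeries

/-! ### Reducing pairs and the proof of the theorem -/

section ReducingPair

theorem mem_smul_top_pi_iff {A ι : Type*} [CommRing A] [Fintype ι] (I : Ideal A) (v : ι → A) :
    v ∈ (I • ⊤ : Submodule A (ι → A)) ↔ ∀ i, v i ∈ I := by
  classical
  constructor
  · intro hv i
    have := Submodule.smul_top_le_comap_smul_top I (LinearMap.proj i : (ι → A) →ₗ[A] A) hv
    simpa using this
  · intro hv
    rw [pi_eq_sum_univ' v]
    exact sum_mem fun i _ => Submodule.smul_mem_smul (hv i) trivial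

/-- Since g I F ⊆ I im ψ = ψ(I M), g v differs from an element of I M by an element of ker ψ. -/
theorem smul_mem_smul_top_of_map_mem {A M F : Type*} [CommRing A] [AddCommGroup M] [Module A M]
    [AddCommGroup F] [Module A F] (I : Ideal A) (ψ : M →ₗ[A] F) {g : A}
    (hg : ∀ f, g • f ∈ LinearMap.range ψ) (hker : LinearMap.ker ψ ≤ I • ⊤) {v : M}
    (hv : ψ v ∈ (I • ⊤ : Submodule A F)) : g • v ∈ (I • ⊤ : Submodule A M) := by
  have h1 : g • ψ v ∈ (I • ⊤ : Submodule A M).map ψ := by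
    have h2 := Submodule.mem_map_of_mem (f := LinearMap.lsmul A F g) hv
    rw [Submodule.map_smul''] at h2
    rw [Submodule.map_smul'', Submodule.map_top]
    refine Submodule.smul_mono le_rfl ?_ h2
    rintro _ ⟨f, -, rfl⟩
    exact hg f
  obtain ⟨w, hw, hwv⟩ := h1
  have h3 : g • v - w ∈ LinearMap.ker ψ := by
    rw [LinearMap.mem_ker, map_sub, map_smul, hwv, sub_self]
  simpa using add_mem (hker h3) hw

theorem Module.Flat.pi_const (R M ι : Type*) [CommRing R] [AddCommGroup M] [Module R M] [Finite ι]
    [Module.Flat R M] : Module.Flat R (ι → M) := by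
  classical
  exact Module.Flat.of_linearEquiv
    ((Finsupp.linearEquivFunOnFinite R M ι).symm.trans (finsuppLEquivDirectSum R M ι))

section RangeQuotient

variable {R A M F : Type*} [CommRing R] [CommRing A] [Algebra R A] [AddCommGroup M] [Module A M]
  [Module R M] [IsScalarTower R A M] [AddCommGroup F] [Module A F] [Module R F]
  [IsScalarTower R A F] {J : Ideal R} (ψ : M →ₗ[A] F)

theorem exact_restrictScalars_mkQ : Function.Exact (ψ.restrictScalars R)
    ((LinearMap.range ψ).mkQ.restrictScalars R) := fun f => by
  simp

theorem IsFlatModulo.of_range (hM : IsFlatModulo J M) (hC : IsFlatModulo J (F ⧸ LinearMap.range ψ))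
    (hψ : ∀ v, ψ v ∈ (J • ⊤ : Submodule R F) → v ∈ (J • ⊤ : Submodule R M)) :
    IsFlatModulo J F :=
  IsFlatModulo.of_extension (exact_restrictScalars_mkQ ψ) (Submodule.mkQ_surjective (LinearMap.range ψ)) hM hC hψ

theorem IsFlatModulo.quotient_range (hF : IsFlatModulo J F)
    (hψ : ∀ I : Ideal R, J ≤ I →
      ∀ v, ψ v ∈ (I • ⊤ : Submodule R F) → v ∈ (I • ⊤ : Submodule R M)) :
    IsFlatModulo J (F ⧸ LinearMap.range ψ) :=
  IsFlatModulo.cokernel (exact_restrictScalars_mkQ ψ) (Submodule.mkQ_surjective (LinearMap.range ψ)) hF hψ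

end RangeQuotient

open IsLocalRing

variable {K : Type*} [RCLike K] {n m : ℕ} {F : Type*} [AddCommGroup F]
  [Module (SeriesRingYX K n m) F]

theorem mem_map_varIdeal_iff (g : SeriesRingYX K n m) :
    g ∈ (ConvergentPowerSeries.varIdeal K (Fin n)).map
      (algebraMap (SeriesRingY K n) (SeriesRingYX K n m)) ↔
      ConvergentPowerSeries.evalZero K (Fin n) (Fin m) g = 0 := by
  rw [← ConvergentPowerSeries.ker_evalZero, RingHom.mem_ker]

/-- Generators independent modulo P = 𝔪A give ψ with kernel in P A^l. Its cokernel C satisfies a C ⊆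
P C for some a ∉ P, so some g ∉ P annihilates C. -/
theorem exists_isReducingPair [Module.Finite (SeriesRingYX K n m) F] :
    ∃ (g : SeriesRingYX K n m) (l : ℕ)
      (ψ : (Fin l → SeriesRingYX K n m) →ₗ[SeriesRingYX K n m] F), IsReducingPair g ψ := by
  let P := (ConvergentPowerSeries.varIdeal K (Fin n)).map
    (algebraMap (SeriesRingY K n) (SeriesRingYX K n m))
  obtain ⟨l, ψ, a, hψ, ha, haF⟩ := exists_linear_map_independent_modulo_prime P F
  obtain ⟨g, hg, hgC⟩ := exists_smul_eq_zero_of_smul_mem P (C := F ⧸ LinearMap.range ψ) ha (by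
    intro x
    obtain ⟨f, rfl⟩ := Submodule.mkQ_surjective _ x
    obtain ⟨u, hu, w, hw, huw⟩ := Submodule.mem_sup.1 (haF f)
    have hu0 : (LinearMap.range ψ).mkQ u = 0 := (Submodule.Quotient.mk_eq_zero _).2 hu
    rw [← map_smul, ← huw, map_add, hu0, zero_add]
    exact Submodule.smul_top_le_comap_smul_top P _ hw)
  refine ⟨g, l, ψ, fun h => hg ((mem_map_varIdeal_iff g).2 h), fun f => ?_, fun v hv => ?_⟩
  · rw [← Submodule.Quotient.mk_eq_zero, Submodule.Quotient.mk_smul]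
    exact hgC _
  · refine (mem_smul_top_pi_iff P v).2 (hψ v ?_)
    rw [LinearMap.mem_ker.1 hv]
    exact zero_mem _

theorem mem_idealMulPow_iff (J : Ideal (SeriesRingY K n)) {l : ℕ}
    (v : Fin l → SeriesRingYX K n m) :
    v ∈ idealMulPow m J l ↔
      v ∈ (J • ⊤ : Submodule (SeriesRingY K n) (Fin l → SeriesRingYX K n m)) :=
  mem_map_smul_top_iff J v

namespace IsReducingPair

variable {g : SeriesRingYX K n m} {l : ℕ}
  {ψ : (Fin l → SeriesRingYX K n m) →ₗ[SeriesRingYX K n m] F}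

/-- Multiplication by `g` is injective modulo the maximal ideal of `R`. -/
theorem mem_of_smul_mem (h : IsReducingPair g ψ) (v : Fin l → SeriesRingYX K n m)
    (hv : g • v ∈ (maximalIdeal (SeriesRingY K n) • ⊤ :
      Submodule (SeriesRingY K n) (Fin l → SeriesRingYX K n m))) :
    v ∈ (maximalIdeal (SeriesRingY K n) • ⊤ :
      Submodule (SeriesRingY K n) (Fin l → SeriesRingYX K n m)) := by
  rw [← ConvergentPowerSeries.varIdeal_eq_maximalIdeal,
    ← mem_map_smul_top_iff (A := SeriesRingYX K n m), mem_smul_top_pi_iff] at hv ⊢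
  intro i
  exact (Ideal.IsPrime.mem_or_mem inferInstance (hv i)).resolve_left
    fun hg => h.1 ((mem_map_varIdeal_iff g).1 hg)

variable [Module (SeriesRingY K n) F] [IsScalarTower (SeriesRingY K n) (SeriesRingYX K n m) F]

/-- This is the input of the local criterion: the kernel condition gives g v ∈ 𝔪 A^l, and g cancels
modulo the prime 𝔪A. -/
theorem mem_of_map_mem_maximalIdeal (h : IsReducingPair g ψ) (v : Fin l → SeriesRingYX K n m)
    (hv : ψ v ∈ (maximalIdeal (SeriesRingY K n) • ⊤ : Submodule (SeriesRingY K n) F)) :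
    v ∈ (maximalIdeal (SeriesRingY K n) • ⊤ :
      Submodule (SeriesRingY K n) (Fin l → SeriesRingYX K n m)) := by
  refine h.mem_of_smul_mem v ?_
  rw [← ConvergentPowerSeries.varIdeal_eq_maximalIdeal,
    ← mem_map_smul_top_iff (A := SeriesRingYX K n m)] at hv ⊢
  exact smul_mem_smul_top_of_map_mem _ ψ h.2.1 h.2.2 hv

/-- Sufficiency: the two conditions for a single reducing pair imply flatness. -/
theorem isFlatModulo (h : IsReducingPair g ψ) {J : Ideal (SeriesRingY K n)}
    (hJ : J ≤ maximalIdeal (SeriesRingY K n)) (hker : LinearMap.ker ψ ≤ idealMulPow m J l)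
    (hC : IsFlatModulo J (F ⧸ LinearMap.range ψ)) : IsFlatModulo J F := by
  have := Module.Flat.pi_const (SeriesRingY K n) (SeriesRingYX K n m) (Fin l)
  refine IsFlatModulo.of_range ψ (Module.Flat.isFlatModulo J) hC fun v hv => ?_
  have hgv := smul_mem_smul_top_of_map_mem _ ψ h.2.1 hker
    ((mem_map_smul_top_iff (A := SeriesRingYX K n m) J (ψ v)).2 hv)
  -- To cancel g in g v ∈ J A^l, the local criterion is applied to multiplication by g on the flat
  -- module A^l.
  refine IsFlatModulo.mem_smul_top_of_map_mem (A := SeriesRingYX K n m)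
    ConvergentPowerSeries.map_maximalIdeal_le_jacobson (Module.Flat.isFlatModulo J) hJ
    ((LinearMap.lsmul (SeriesRingYX K n m) (Fin l → SeriesRingYX K n m) g).restrictScalars
      (SeriesRingY K n)) h.mem_of_smul_mem v ?_
  exact (mem_map_smul_top_iff J _).1 hgv

theorem mem_smul_top_of_map_mem (h : IsReducingPair g ψ) {J : Ideal (SeriesRingY K n)}
    (hF : IsFlatModulo J F) (v : Fin l → SeriesRingYX K n m)
    (hv : ψ v ∈ (J • ⊤ : Submodule (SeriesRingY K n) F)) :
    v ∈ (J • ⊤ : Submodule (SeriesRingY K n) (Fin l → SeriesRingYX K n m)) := by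
  by_cases hJ : J = ⊤
  · rw [hJ, Submodule.top_smul]
    trivial
  exact hF.mem_smul_top_of_map_mem (A := SeriesRingYX K n m)
    ConvergentPowerSeries.map_maximalIdeal_le_jacobson (le_maximalIdeal hJ)
    (ψ.restrictScalars (SeriesRingY K n)) h.mem_of_map_mem_maximalIdeal v hv

theorem ker_le (h : IsReducingPair g ψ) {J : Ideal (SeriesRingY K n)} (hF : IsFlatModulo J F) :
    LinearMap.ker ψ ≤ idealMulPow m J l := fun v hv =>
  (mem_idealMulPow_iff J v).2 (h.mem_smul_top_of_map_mem hF v (by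
    rw [LinearMap.mem_ker.1 hv]
    exact zero_mem _))

/-- Flatness modulo J passes to every larger ideal, so the local criterion makes ψ injective modulo
all of them, as `IsFlatModulo.cokernel` requires. -/
theorem isFlatModulo_quotient (h : IsReducingPair g ψ) {J : Ideal (SeriesRingY K n)}
    (hF : IsFlatModulo J F) : IsFlatModulo J (F ⧸ LinearMap.range ψ) :=
  IsFlatModulo.quotient_range ψ hF
    fun _ hI => h.mem_smul_top_of_map_mem (hF.mono hI)

end IsReducingPair

theorem isFlatModulo_top {R M : Type*} [CommRing R] [AddCommGroup M] [Module R M] :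
    IsFlatModulo (⊤ : Ideal R) M := fun _ _ _ _ =>
  ⟨0, 0, 0, by simp, by simp⟩

end ReducingPair

theorem theorem1p1 {K : Type*} [RCLike K] (n m : ℕ) (F : Type*) [AddCommGroup F]
    [Module (SeriesRingYX K n m) F] [Module.Finite (SeriesRingYX K n m) F]
    [Module (SeriesRingY K n) F] [IsScalarTower (SeriesRingY K n) (SeriesRingYX K n m) F] :
    -- Part (A)
    (∃ (g : SeriesRingYX K n m) (l : ℕ)
      (ψ : (Fin l → SeriesRingYX K n m) →ₗ[SeriesRingYX K n m] F), IsReducingPair g ψ) ∧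
    -- Part (B), with the converse for each single choice of `g`, `l`, `ψ`
    ∀ J : Ideal (SeriesRingY K n),
      (Module.Flat (SeriesRingY K n ⧸ J) ((SeriesRingY K n ⧸ J) ⊗[SeriesRingY K n] F) ↔
        ∀ (g : SeriesRingYX K n m) (l : ℕ)
          (ψ : (Fin l → SeriesRingYX K n m) →ₗ[SeriesRingYX K n m] F), IsReducingPair g ψ →
          LinearMap.ker ψ ≤ idealMulPow m J l ∧
          Module.Flat (SeriesRingY K n ⧸ J)
            ((SeriesRingY K n ⧸ J) ⊗[SeriesRingY K n] (F ⧸ LinearMap.range ψ))) ∧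
      ∀ (g : SeriesRingYX K n m) (l : ℕ)
        (ψ : (Fin l → SeriesRingYX K n m) →ₗ[SeriesRingYX K n m] F), IsReducingPair g ψ →
        LinearMap.ker ψ ≤ idealMulPow m J l →
        Module.Flat (SeriesRingY K n ⧸ J)
          ((SeriesRingY K n ⧸ J) ⊗[SeriesRingY K n] (F ⧸ LinearMap.range ψ)) →
        Module.Flat (SeriesRingY K n ⧸ J) ((SeriesRingY K n ⧸ J) ⊗[SeriesRingY K n] F) := by
  refine ⟨exists_isReducingPair, fun J => ?_⟩
  simp only [flat_quotient_tensor_iff]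
  have single : ∀ (g : SeriesRingYX K n m) (l : ℕ)
      (ψ : (Fin l → SeriesRingYX K n m) →ₗ[SeriesRingYX K n m] F), IsReducingPair g ψ →
      LinearMap.ker ψ ≤ idealMulPow m J l → IsFlatModulo J (F ⧸ LinearMap.range ψ) →
      IsFlatModulo J F := by
    intro g l ψ h hker hC
    -- The local criterion needs J ≤ 𝔪; for J = ⊤ flatness over the zero ring is automatic.
    by_cases hJ : J = ⊤
    · exact hJ ▸ isFlatModulo_top
    · exact h.isFlatModulo (IsLocalRing.le_maximalIdeal hJ) hker hC
  refine ⟨⟨fun hF g l ψ h => ⟨h.ker_le hF, h.isFlatModulo_quotient hF⟩, fun hall => ?_⟩, single⟩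
  -- Part (A) keeps the universally quantified hypothesis from being vacuous.
  obtain ⟨g, l, ψ, h⟩ := exists_isReducingPair (K := K) (n := n) (m := m) (F := F)
  exact single g l ψ h (hall g l ψ h).1 (hall g l ψ h).2
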